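/- **Setting.** Let $N\cong\mathbb Z^n$ be a lattice with dual lattice $M=\operatorname{Hom}(N,\mathbb Z)$, put $N_{\mathbb R}=N\otimes\mathbb R$ and $M_{\mathbb R}=M\otimes\mathbb R$, and let $\Delta$ be a fan in $N_{\mathbb R}$ (a finite set of strongly convex rational polyhedral cones, closed under taking faces, any two of which meet in a common face). Let $\Delta(1)$ be its set of rays, $\mathbf v_i\in N$ the first lattice point on the ray $i\in\Delta(1)$, and $|\Delta|$ the union of its cones. For a cone $\tau\in\Delta$ write $i\in\tau$ if the $i$-th ray is a ray of $\tau$. Let $k$ be a field and $X_\Delta$ the toric variety over $k$ obtained by gluing the affine varieties $U_\tau=\operatorname{Spec}k[\tau^\vee\cap M]$, $\tau\in\Delta$. For $i\in\Delta(1)$ let $D_i$ be the corresponding torus-invariant prime divisor, so that $\operatorname{div}(\chi^{u})=\sum_i\langle u,\mathbf v_i\rangle D_i$ for $u\in M$. For $\sigma\in\Delta$ let $V(\sigma)$ be the closure, with its reduced structure, of the torus orbit $\mathcal O(\sigma)$ of $\sigma$, and $i_\sigma\colon V(\sigma)\to X_\Delta$ the inclusion. Let $\operatorname{star}^1(\sigma)$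 be the fan consisting of $\sigma$, of all $\tau\in\Delta$ with $\sigma\subseteq\tau$ and $\dim\tau=\dim\sigma+1$, and of all faces of these cones; write $i\in\operatorname{star}^1(\sigma)$ if the $i$-th ray belongs to this fan. Let $D=\sum_{i\in\Delta(1)}a_iD_i$ be a torus-invariant Cartier divisor on $X_\Delta$: for each $\tau\in\Delta$ there is $u(\tau)\in M$ such that $\chi^{-u(\tau)}$ is a local equation of $D$ on $U_\tau$; in particular $\langle u(\tau),\mathbf v_i\rangle=-a_i$ for $i\in\tau$. Let $\psi_D\colon|\Delta|\to\mathbb R$ be the function that is linear on each cone of $\Delta$ and satisfies $\psi_D(\mathbf v_i)=a_i$. **Proposition.** For every $\sigma\in\Delta$ the following are equivalent: 1. $i_\sigma^*[D]$ is effective in $\operatorname{Pic}(V(\sigma))_{\mathbb R}$, that is, for some integer $m>0$ the line bundle $i_\sigma^*\mathcal O_{X_\Delta}(mD)$ has a nonzero global section (equivalently, $m\,i_\sigma^*[D]$ is the class of an effective Cartier divisor on $V(\sigma)$); 2. there is a divisor $D'=\sum_i a_i'D_i$ with real coefficients such that $[D]=[D']$ in $\operatorname{Pic}(X_\Delta)_{\mathbb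 R}$ (that is, $D'-D$ is a real linear combination of divisors $\operatorname{div}(\chi^u)$, $u\in M$), $a_i'=0$ for all $i\in\sigma$, and $a_i'\ge 0$ for all $i\in\operatorname{star}^1(\sigma)$; 3. $\psi_D$ is convex on $\operatorname{star}^1(\sigma)$: for all $l\ge 0$ and all points $\mathbf u_1,\dots,\mathbf u_l$ in the union of the cones of $\operatorname{star}^1(\sigma)$ with $\sum_{j=1}^l\mathbf u_j\in\sigma$ one has $\psi_D\bigl(\sum_{j=1}^l\mathbf u_j\bigr)\le\sum_{j=1}^l\psi_D(\mathbf u_j)$; 4. $\sum_{i\in\Delta(1)}a_ib_i\ge 0$ for all $\mathbf b=(b_i)\in\mathbb R^{\Delta(1)}$ with $\sum_{i\in\Delta(1)}b_i\mathbf v_i=0$, with $b_i=0$ for $i\notin\operatorname{star}^1(\sigma)$, and with $b_i\ge 0$ for all $i\in\operatorname{star}^1(\sigma)$ with $i\notin\sigma$. -/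

import Mathlib

universe u

noncomputable section

namespace Toric

open CategoryTheory CategoryTheory.Limits AlgebraicGeometry TopologicalSpace Opposite
open scoped TensorProduct

section Lattice

variable (N : Type u) [AddCommGroup N]

/-- The real vector space `N ⊗ ℝ` of the lattice `N`. -/
abbrev RealSpace : Type u := ℝ ⊗[ℤ] N

/-- The dual lattice `Hom(N, ℤ)`. -/
abbrev DualLattice : Type u := N →ₗ[ℤ] ℤ

variable {N}

/-- The lattice vector `v`, seen in `N ⊗ ℝ`. -/
def latticeVec (v : N) : RealSpace N := (1 : ℝ) ⊗ₜ[ℤ] v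

/-- The real linear form `⟨u, ·⟩` on `N ⊗ ℝ` given by `u ∈ Hom(N, ℤ)`. -/
def pair (u : DualLattice N) : RealSpace N →ₗ[ℝ] ℝ :=
  (TensorProduct.AlgebraTensorModule.rid ℤ ℝ ℝ).toLinearMap ∘ₗ u.baseChange ℝ

theorem pair_latticeVec (u : DualLattice N) (v : N) : pair u (latticeVec v) = (u v : ℝ) := by
  simp [pair, latticeVec]

theorem pair_add (u w : DualLattice N) (x : RealSpace N) :
    pair (u + w) x = pair u x + pair w x := by
  simp [pair, LinearMap.baseChange_add]

theorem pair_zero (x : RealSpace N) : pair (0 : DualLattice N) x = 0 := by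
  simp [pair]

theorem pair_neg (u : DualLattice N) (x : RealSpace N) : pair (-u) x = -pair u x := by
  have := pair_add u (-u) x
  rw [add_neg_cancel, pair_zero] at this
  linarith

theorem pair_sub (u w : DualLattice N) (x : RealSpace N) :
    pair (u - w) x = pair u x - pair w x := by
  rw [sub_eq_add_neg, pair_add, pair_neg, sub_eq_add_neg]

theorem pair_nsmul (n : ℕ) (u : DualLattice N) (x : RealSpace N) :
    pair (n • u) x = n * pair u x := by
  induction n with
  | zero => simp [pair_zero]
  | succ n ih => rw [succ_nsmul, pair_add, ih]; push_cast; ring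

/-- A cone in `N ⊗ ℝ` is rational polyhedral if it is generated by finitely many lattice vectors. -/
def IsRationalPolyhedral (τ : PointedCone ℝ (RealSpace N)) : Prop :=
  ∃ S : Finset N, τ = PointedCone.hull ℝ (latticeVec '' (S : Set N))

/-- `ρ` is a face of the rational polyhedral cone `τ`: it is cut out of `τ` by the hyperplane
`u = 0` for some `u` in the dual lattice that is nonnegative on `τ`. -/
def IsFace (ρ τ : PointedCone ℝ (RealSpace N)) : Prop :=
  ∃ u : DualLattice N, (∀ x ∈ τ, 0 ≤ pair u x) ∧ ∀ x, x ∈ ρ ↔ x ∈ τ ∧ pair u x = 0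

theorem IsFace.le {ρ τ : PointedCone ℝ (RealSpace N)} (h : IsFace ρ τ) : ρ ≤ τ := by
  obtain ⟨u, -, hu⟩ := h
  exact fun x hx => ((hu x).1 hx).1

/-- The dimension of a cone is the dimension of its linear span. -/
def coneDim (τ : PointedCone ℝ (RealSpace N)) : ℕ :=
  Module.finrank ℝ (Submodule.span ℝ (τ : Set (RealSpace N)))

/-- The monoid `τ^∨ ∩ M` of all `u` in the dual lattice that are nonnegative on `τ`. -/
def dualMonoid (τ : PointedCone ℝ (RealSpace N)) : AddSubmonoid (DualLattice N) where
  carrier := {u | ∀ x ∈ τ, 0 ≤ pair u x}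
  zero_mem' := fun x _ => by simp [pair_zero]
  add_mem' := fun {u w} hu hw x hx => by
    rw [pair_add]; exact add_nonneg (hu x hx) (hw x hx)

theorem mem_dualMonoid {τ : PointedCone ℝ (RealSpace N)} {u : DualLattice N} :
    u ∈ dualMonoid τ ↔ ∀ x ∈ τ, 0 ≤ pair u x := Iff.rfl

theorem dualMonoid_anti {ρ τ : PointedCone ℝ (RealSpace N)} (h : ρ ≤ τ) :
    dualMonoid τ ≤ dualMonoid ρ := fun _ hu x hx => hu x (h hx)

/-- If `u` cuts out the face `ρ` of `τ`, then every lattice form nonnegative on `ρ` becomes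
nonnegative on `τ` after adding a multiple of `u`. -/
theorem exists_add_nsmul_mem {ρ τ : PointedCone ℝ (RealSpace N)} (hτ : IsRationalPolyhedral τ)
    {u : DualLattice N} (hu : u ∈ dualMonoid τ) (hρ : ∀ x, x ∈ ρ ↔ x ∈ τ ∧ pair u x = 0)
    {w : DualLattice N} (hw : w ∈ dualMonoid ρ) :
    ∃ n : ℕ, w + n • u ∈ dualMonoid τ := by
  obtain ⟨S, rfl⟩ := hτ
  refine ⟨∑ s ∈ S, (w s).natAbs, fun x hx => ?_⟩
  induction hx using Submodule.span_induction with
  | mem x h =>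
    obtain ⟨s, hs, rfl⟩ := h
    have hmem : latticeVec s ∈ PointedCone.hull ℝ (latticeVec '' (S : Set N)) :=
      Submodule.subset_span ⟨s, hs, rfl⟩
    have h0 := hu _ hmem
    rw [pair_add, pair_nsmul]
    by_cases h1 : pair u (latticeVec s) = 0
    · rw [h1]
      simpa using hw _ ((hρ _).2 ⟨hmem, h1⟩)
    · rw [pair_latticeVec] at h0 h1 ⊢
      rw [pair_latticeVec]
      have h2 : 0 ≤ u s := by exact_mod_cast h0
      have h3 : u s ≠ 0 := by exact_mod_cast h1
      have h4 : 1 ≤ u s := by omega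
      have h5 : (w s).natAbs ≤ ∑ s ∈ S, (w s).natAbs :=
        Finset.single_le_sum (f := fun s => (w s).natAbs) (fun _ _ => Nat.zero_le _) hs
      have h6 : (0 : ℤ) ≤ w s + ((∑ s ∈ S, (w s).natAbs : ℕ) : ℤ) * u s := by
        have h7 : ((w s).natAbs : ℤ) ≤ ((∑ s ∈ S, (w s).natAbs : ℕ) : ℤ) := by exact_mod_cast h5
        have h8 : ((∑ s ∈ S, (w s).natAbs : ℕ) : ℤ) ≤ ((∑ s ∈ S, (w s).natAbs : ℕ) : ℤ) * u s :=
          le_mul_of_one_le_right (by positivity) h4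
        have h9 := neg_abs_le (w s)
        rw [Int.natCast_natAbs] at h7
        linarith
      have h10 : (0 : ℝ) ≤ ((w s + ((∑ s ∈ S, (w s).natAbs : ℕ) : ℤ) * u s : ℤ) : ℝ) :=
        Int.cast_nonneg h6
      rw [Int.cast_add, Int.cast_mul, Int.cast_natCast] at h10
      exact h10
  | zero => simp
  | add x y _ _ hx hy => rw [map_add]; exact add_nonneg hx hy
  | smul a x _ hx =>
    have : pair (w + (∑ s ∈ S, (w s).natAbs) • u) (a • x) =
      (a : ℝ) * pair (w + (∑ s ∈ S, (w s).natAbs) • u) x := by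
      rw [← smul_eq_mul, ← map_smul]; rfl
    rw [this]
    exact mul_nonneg a.2 hx

end Lattice

section CoordinateRing

variable {N : Type u} [AddCommGroup N] (k : Type u) [Field k]

/-- The coordinate ring `k[τ^∨ ∩ M]` of the affine toric variety of the cone `τ`. -/
abbrev CoordRing (τ : PointedCone ℝ (RealSpace N)) : Type u :=
  AddMonoidAlgebra k (dualMonoid τ)

/-- The character `χ^u`, for `u ∈ τ^∨ ∩ M`, as an element of `k[τ^∨ ∩ M]`. -/
def character {τ : PointedCone ℝ (RealSpace N)} (u : dualMonoid τ) : CoordRing k τ :=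
  AddMonoidAlgebra.single u 1

theorem character_mul {τ : PointedCone ℝ (RealSpace N)} (u w : dualMonoid τ) :
    character k u * character k w = character k (u + w) := by
  simp [character, AddMonoidAlgebra.single_mul_single]

theorem character_zero {τ : PointedCone ℝ (RealSpace N)} :
    character k (0 : dualMonoid τ) = 1 := rfl

/-- The inclusion `k[τ^∨ ∩ M] → k[ρ^∨ ∩ M]` for `ρ ≤ τ`. -/
def coordMap {ρ τ : PointedCone ℝ (RealSpace N)} (h : ρ ≤ τ) : CoordRing k τ →+* CoordRing k ρ :=
  AddMonoidAlgebra.mapDomainRingHom k (AddSubmonoid.inclusion (dualMonoid_anti h))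

theorem coordMap_character {ρ τ : PointedCone ℝ (RealSpace N)} (h : ρ ≤ τ) (u : dualMonoid τ) :
    coordMap k h (character k u) = character k (AddSubmonoid.inclusion (dualMonoid_anti h) u) := by
  simp [coordMap, character]

theorem coordMap_single {ρ τ : PointedCone ℝ (RealSpace N)} (h : ρ ≤ τ) (u : dualMonoid τ) (r : k) :
    coordMap k h (AddMonoidAlgebra.single u r) =
      AddMonoidAlgebra.single (AddSubmonoid.inclusion (dualMonoid_anti h) u) r := by
  simp [coordMap]

theorem coordMap_injective {ρ τ : PointedCone ℝ (RealSpace N)} (h : ρ ≤ τ) :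
    Function.Injective (coordMap k h) :=
  AddMonoidAlgebra.mapDomain_injective (AddSubmonoid.inclusion_injective (dualMonoid_anti h))

theorem coordMap_refl (τ : PointedCone ℝ (RealSpace N)) :
    coordMap k (le_refl τ) = RingHom.id _ :=
  AddMonoidAlgebra.mapDomainRingHom_id

theorem coordMap_comp {π ρ τ : PointedCone ℝ (RealSpace N)} (h : π ≤ ρ) (h' : ρ ≤ τ) :
    (coordMap k h).comp (coordMap k h') = coordMap k (h.trans h') := by
  rw [coordMap, coordMap, coordMap, ← AddMonoidAlgebra.mapDomainRingHom_comp]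
  rfl

/-- If `u` cuts out the face `ρ` of `τ`, then `k[ρ^∨ ∩ M]` is the localization of `k[τ^∨ ∩ M]`
at `χ^u`. -/
theorem isLocalization_coordMap {ρ τ : PointedCone ℝ (RealSpace N)} (hτ : IsRationalPolyhedral τ)
    (h : ρ ≤ τ) (u : dualMonoid τ) (hρ : ∀ x, x ∈ ρ ↔ x ∈ τ ∧ pair (u : DualLattice N) x = 0) :
    letI := (coordMap k h).toAlgebra
    IsLocalization.Away (character k u) (CoordRing k ρ) := by
  let := (coordMap k h).toAlgebra
  have hneg : -(u : DualLattice N) ∈ dualMonoid ρ := fun x hx => by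
    rw [pair_neg, ((hρ x).1 hx).2, neg_zero]
  have hunit : IsUnit (coordMap k h (character k u)) := by
    rw [coordMap_character]
    refine .of_mul_eq_one (character k ⟨-(u : DualLattice N), hneg⟩) ?_
    rw [character_mul, ← character_zero]
    congr 1
    ext1
    simp
  have hpow : ∀ n : ℕ, character k u ^ n = character k (n • u) := by
    intro n
    induction n with
    | zero => simp [character_zero]
    | succ n ih => rw [pow_succ, ih, character_mul, succ_nsmul]
  refine ⟨?_, ?_, ?_⟩
  · rintro ⟨_, n, rfl⟩
    rw [map_pow]
    exact hunit.pow n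
  · intro z
    induction z using AddMonoidAlgebra.induction_linear with
    | zero => exact ⟨(0, 1), by simp⟩
    | add z z' hz hz' =>
      obtain ⟨⟨a, s⟩, ha⟩ := hz
      obtain ⟨⟨b, t⟩, hb⟩ := hz'
      refine ⟨(a * t + b * s, s * t), ?_⟩
      simp only [Submonoid.coe_mul, map_mul, map_add] at *
      rw [← ha, ← hb]; ring
    | single w r =>
      obtain ⟨n, hn⟩ := exists_add_nsmul_mem hτ u.2 hρ w.2
      refine ⟨(AddMonoidAlgebra.single ⟨_, hn⟩ r, ⟨character k u ^ n, n, rfl⟩), ?_⟩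
      change AddMonoidAlgebra.single w r * coordMap k h (character k u ^ n) =
        coordMap k h (AddMonoidAlgebra.single ⟨_, hn⟩ r)
      rw [hpow, coordMap_character, coordMap_single, character, AddMonoidAlgebra.single_mul_single,
        mul_one]
      congr 1
  · intro x y hxy
    exact ⟨1, by rw [coordMap_injective k h hxy]⟩

end CoordinateRing

section Fan

/-- A fan in `N ⊗ ℝ`: a finite set of strongly convex rational polyhedral cones that contains every
face of each of its cones and in which any two cones meet in a common face. -/
structure Fan (N : Type u) [AddCommGroup N] where
  cones : Set (PointedCone ℝ (RealSpace N))
  finite : cones.Finite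
  rational : ∀ τ ∈ cones, IsRationalPolyhedral τ
  stronglyConvex : ∀ τ ∈ cones, ∀ x ∈ τ, -x ∈ τ → x = 0
  face_mem : ∀ τ ∈ cones, ∀ ρ, IsFace ρ τ → ρ ∈ cones
  inf_isFace : ∀ τ ∈ cones, ∀ τ' ∈ cones, IsFace (τ ⊓ τ') τ ∧ IsFace (τ ⊓ τ') τ'

variable {N : Type u} [AddCommGroup N] (Δ : Fan N)

/-- The cones of a fan, ordered by inclusion; for cones of a fan `ρ ≤ τ` means that `ρ` is a face
of `τ`. -/
abbrev Fan.Cone : Type u := {τ : PointedCone ℝ (RealSpace N) // τ ∈ Δ.cones}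

instance : Finite Δ.Cone := Δ.finite

variable {Δ} in
theorem Fan.isFace_of_le {ρ τ : Δ.Cone} (h : ρ ≤ τ) : IsFace ρ.1 τ.1 := by
  have := (Δ.inf_isFace ρ.1 ρ.2 τ.1 τ.2).2
  rwa [inf_eq_left.2 (show ρ.1 ≤ τ.1 from h)] at this

/-- The intersection of two cones of a fan. -/
def Fan.meet (τ τ' : Δ.Cone) : Δ.Cone :=
  ⟨τ.1 ⊓ τ'.1, Δ.face_mem _ τ.2 _ (Δ.inf_isFace _ τ.2 _ τ'.2).1⟩

theorem Fan.meet_le_left (τ τ' : Δ.Cone) : Δ.meet τ τ' ≤ τ := 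
  show τ.1 ⊓ τ'.1 ≤ τ.1 from inf_le_left

theorem Fan.meet_le_right (τ τ' : Δ.Cone) : Δ.meet τ τ' ≤ τ' := 
  show τ.1 ⊓ τ'.1 ≤ τ'.1 from inf_le_right

end Fan

section ToricVariety

variable {N : Type u} [AddCommGroup N] (Δ : Fan N) (k : Type u) [Field k]

/-- The diagram of the affine toric varieties `U_τ = Spec k[τ^∨ ∩ M]`, for `τ` in the fan, with the
inclusions `U_ρ → U_τ` for the faces `ρ` of `τ`. -/
def Fan.diagram : Δ.Cone ⥤ Scheme.{u} where
  obj τ := Spec (.of (CoordRing k τ.1))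
  map {ρ τ} f := Spec.map (CommRingCat.ofHom (coordMap k (leOfHom f)))
  map_id τ := by
    rw [coordMap_refl]
    exact Spec.map_id _
  map_comp {π ρ τ} f g := by
    rw [← Spec.map_comp, ← CommRingCat.ofHom_comp, coordMap_comp]

instance diagram_isOpenImmersion {ρ τ : Δ.Cone} (f : ρ ⟶ τ) :
    IsOpenImmersion ((Δ.diagram k).map f) := by
  obtain ⟨u, hu, hρ⟩ := Fan.isFace_of_le (leOfHom f)
  let := (coordMap k (leOfHom f)).toAlgebra
  have := isLocalization_coordMap k (Δ.rational _ τ.2) (leOfHom f) ⟨u, hu⟩ hρ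
  exact IsOpenImmersion.of_isLocalization (character k ⟨u, hu⟩)

theorem range_diagram_map {ρ τ : Δ.Cone} (f : ρ ⟶ τ) (u : dualMonoid τ.1)
    (hρ : ∀ x, x ∈ ρ.1 ↔ x ∈ τ.1 ∧ pair (u : DualLattice N) x = 0) :
    Set.range ((Δ.diagram k).map f) = {p : PrimeSpectrum (CoordRing k τ.1) |
      character k u ∉ p.asIdeal} := by
  let := (coordMap k (leOfHom f)).toAlgebra
  have := isLocalization_coordMap k (Δ.rational _ τ.2) (leOfHom f) u hρ
  exact PrimeSpectrum.localization_away_comap_range (CoordRing k ρ.1) (character k u)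

instance diagram_isLocallyDirected : (Δ.diagram k ⋙ Scheme.forget).IsLocallyDirected where
  cond {i j κ} fi fj xi xj h := by
    obtain ⟨u, hu, hi⟩ := Fan.isFace_of_le (leOfHom fi)
    obtain ⟨w, hw, hj⟩ := Fan.isFace_of_le (leOfHom fj)
    let li : Δ.meet i j ⟶ i := homOfLE (Δ.meet_le_left i j)
    let lj : Δ.meet i j ⟶ j := homOfLE (Δ.meet_le_right i j)
    have h' : (Δ.diagram k).map fi xi = (Δ.diagram k).map fj xj := h
    have h1 : (Δ.diagram k).map fi xi ∈ Set.range ((Δ.diagram k).map fi) := ⟨xi, rfl⟩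
    have h2 : (Δ.diagram k).map fi xi ∈ Set.range ((Δ.diagram k).map fj) := ⟨xj, h'.symm⟩
    rw [range_diagram_map Δ k fi ⟨u, hu⟩ hi] at h1
    rw [range_diagram_map Δ k fj ⟨w, hw⟩ hj] at h2
    have h3 : (Δ.diagram k).map fi xi ∈ Set.range ((Δ.diagram k).map (li ≫ fi)) := by
      rw [range_diagram_map Δ k (li ≫ fi) (⟨u, hu⟩ + ⟨w, hw⟩)]
      · rw [← character_mul]
        intro h4
        rcases Ideal.IsPrime.mem_or_mem (PrimeSpectrum.isPrime _) h4 with h5 | h5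
        · exact h1 h5
        · exact h2 h5
      · intro x
        change x ∈ i.1 ⊓ j.1 ↔ x ∈ κ.1 ∧ pair (u + w) x = 0
        rw [Submodule.mem_inf, hi, hj, pair_add]
        constructor
        · rintro ⟨⟨a, b⟩, -, c⟩
          exact ⟨a, by rw [b, c, add_zero]⟩
        · rintro ⟨a, b⟩
          have := hu x a
          have := hw x a
          exact ⟨⟨a, by linarith⟩, a, by linarith⟩
    obtain ⟨x, hx⟩ := h3
    have e1 : (Δ.diagram k).map li x = xi := by
      apply ((Δ.diagram k).map fi).isOpenEmbedding.injective
      rw [← hx, Functor.map_comp, Scheme.Hom.comp_apply]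
    have e2 : (Δ.diagram k).map lj x = xj := by
      apply ((Δ.diagram k).map fj).isOpenEmbedding.injective
      rw [← h', ← hx, Subsingleton.elim (li ≫ fi) (lj ≫ fj), Functor.map_comp,
        Scheme.Hom.comp_apply]
    exact ⟨_, li, lj, x, e1, e2⟩

/-- The toric variety of the fan `Δ` over the field `k`: the affine toric varieties `U_τ` glued
along the open subsets `U_ρ` for common faces `ρ`. -/
def Fan.toricVariety : Scheme.{u} := colimit (Δ.diagram k)

/-- The inclusion of the affine toric variety `U_τ` as an open subscheme. -/
def Fan.chart (τ : Δ.Cone) : Spec (.of (CoordRing k τ.1)) ⟶ Δ.toricVariety k :=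
  colimit.ι (Δ.diagram k) τ

instance (τ : Δ.Cone) : IsOpenImmersion (Δ.chart k τ) :=
  inferInstanceAs (IsOpenImmersion (colimit.ι (Δ.diagram k) τ))


theorem Fan.map_chart {ρ τ : Δ.Cone} (h : ρ ≤ τ) :
    Spec.map (CommRingCat.ofHom (coordMap k h)) ≫ Δ.chart k τ = Δ.chart k ρ :=
  colimit.w (Δ.diagram k) (homOfLE h)

/-- The open subset `U_τ` of the toric variety. -/
abbrev Fan.chartOpen (τ : Δ.Cone) : (Δ.toricVariety k).Opens := (Δ.chart k τ).opensRange

theorem Fan.chartOpen_mono {ρ τ : Δ.Cone} (h : ρ ≤ τ) : Δ.chartOpen k ρ ≤ Δ.chartOpen k τ := by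
  rintro _ ⟨x, rfl⟩
  refine ⟨Spec.map (CommRingCat.ofHom (coordMap k h)) x, ?_⟩
  rw [← Scheme.Hom.comp_apply, Fan.map_chart]

theorem Fan.inf_chartOpen_le (τ τ' : Δ.Cone) :
    Δ.chartOpen k τ ⊓ Δ.chartOpen k τ' ≤ Δ.chartOpen k (Δ.meet τ τ') := by
  rintro _ ⟨⟨x, rfl⟩, ⟨y, hy⟩⟩
  obtain ⟨κ, f, f', z, rfl, rfl⟩ :=
    (Scheme.IsLocallyDirected.ι_eq_ι_iff (Δ.diagram k) (xi := x) (xj := y)).1 hy.symm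
  have hκ : κ ≤ Δ.meet τ τ' :=
    show κ.1 ≤ τ.1 ⊓ τ'.1 from le_inf (leOfHom f) (leOfHom f')
  refine Δ.chartOpen_mono k hκ ⟨z, ?_⟩
  rw [← Δ.map_chart k (leOfHom f)]
  exact Scheme.Hom.comp_apply _ _ _

theorem Fan.iSup_chartOpen : ⨆ τ, Δ.chartOpen k τ = ⊤ := by
  refine top_le_iff.1 fun x _ => ?_
  obtain ⟨τ, y, rfl⟩ := Scheme.IsLocallyDirected.ι_jointly_surjective (Δ.diagram k) x
  exact Opens.mem_iSup.2 ⟨τ, y, rfl⟩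

/-- The orbit `O(σ)`: the closed subset of `U_σ` on which all characters in `σ^∨ ∩ M` that are not
identically zero on `σ` vanish. -/
def Fan.orbit (σ : Δ.Cone) : Set (Δ.toricVariety k) :=
  Δ.chart k σ '' {p : PrimeSpectrum (CoordRing k σ.1) |
    ∀ u : dualMonoid σ.1, (∃ x ∈ σ.1, pair (u : DualLattice N) x ≠ 0) →
      character k u ∈ p.asIdeal}

/-- The ideal sheaf of the closure of the orbit `O(σ)`. -/
def Fan.orbitClosureIdeal (σ : Δ.Cone) : (Δ.toricVariety k).IdealSheafData :=
  Scheme.IdealSheafData.vanishingIdeal (Closeds.closure (Δ.orbit k σ))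

/-- The orbit closure `V(σ)`, as a reduced closed subscheme. -/
def Fan.orbitClosure (σ : Δ.Cone) : Scheme.{u} := (Δ.orbitClosureIdeal k σ).subscheme

/-- The inclusion `V(σ) → X_Δ`. -/
def Fan.orbitClosureι (σ : Δ.Cone) : Δ.orbitClosure k σ ⟶ Δ.toricVariety k :=
  (Δ.orbitClosureIdeal k σ).subschemeι

end ToricVariety

section LineBundle

/-- Restriction of functions on a scheme to a smaller open subset. -/
def res (X : Scheme.{u}) {U V : X.Opens} (h : V ≤ U) : Γ(X, U) →+* Γ(X, V) :=
  (X.presheaf.map (homOfLE h).op).hom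

theorem res_res (X : Scheme.{u}) {U V W : X.Opens} (h : V ≤ U) (h' : W ≤ V) (s : Γ(X, U)) :
    res X h' (res X h s) = res X (h'.trans h) s := by
  simp only [res, ← CommRingCat.comp_apply, ← Functor.map_comp]
  rfl

/-- A line bundle on a scheme, given by an open cover and a cocycle of transition functions. -/
structure LineBundle (X : Scheme.{u}) where
  index : Type u
  opens : index → X.Opens
  iSup_opens : ⨆ i, opens i = ⊤
  trans : ∀ i j, Γ(X, opens i ⊓ opens j)ˣ
  cocycle : ∀ i j l,
    res X (show opens i ⊓ opens j ⊓ opens l ≤ opens i ⊓ opens j from inf_le_left)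
        (trans i j : Γ(X, opens i ⊓ opens j)) *
      res X (show opens i ⊓ opens j ⊓ opens l ≤ opens j ⊓ opens l from
        le_inf (inf_le_left.trans inf_le_right) inf_le_right)
        (trans j l : Γ(X, opens j ⊓ opens l)) =
    res X (show opens i ⊓ opens j ⊓ opens l ≤ opens i ⊓ opens l from
        le_inf (inf_le_left.trans inf_le_left) inf_le_right)
        (trans i l : Γ(X, opens i ⊓ opens l))

namespace LineBundle

variable {X Y : Scheme.{u}}

/-- The tensor power `L^m`. -/
def pow (L : LineBundle X) (m : ℕ) : LineBundle X where
  index := L.index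
  opens := L.opens
  iSup_opens := L.iSup_opens
  trans i j := L.trans i j ^ m
  cocycle i j l := by
    simp only [Units.val_pow_eq_pow_val, map_pow, ← mul_pow, L.cocycle]

/-- The pullback of a line bundle along a morphism `f`. -/
def pullback (L : LineBundle X) (f : Y ⟶ X) : LineBundle Y where
  index := L.index
  opens i := f ⁻¹ᵁ L.opens i
  iSup_opens := by
    rw [← Scheme.Hom.preimage_iSup, L.iSup_opens, Scheme.Hom.preimage_top]
  trans i j := Units.map (f.app (L.opens i ⊓ L.opens j)).hom.toMonoidHom (L.trans i j)
  cocycle i j l := by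
    have key : ∀ {U V : X.Opens} (h : V ≤ U) (h' : f ⁻¹ᵁ V ≤ f ⁻¹ᵁ U) (s : Γ(X, U)),
        res Y h' ((f.app U).hom s) = (f.app V).hom (res X h s) := by
      intro U V h h' s
      exact (ConcreteCategory.congr_hom (f.naturality (homOfLE h).op) s).symm
    have := congrArg (f.app (L.opens i ⊓ L.opens j ⊓ L.opens l)).hom (L.cocycle i j l)
    rw [map_mul, ← key, ← key, ← key] at this
    exact this

/-- A global section of a line bundle: a family of functions on the members of the cover that are
related by the transition functions. -/
def IsSection (L : LineBundle X) (s : ∀ i, Γ(X, L.opens i)) : Prop :=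
  ∀ i j, res X (inf_le_right : L.opens i ⊓ L.opens j ≤ L.opens j) (s j) =
    (L.trans i j : Γ(X, L.opens i ⊓ L.opens j)) *
      res X (inf_le_left : L.opens i ⊓ L.opens j ≤ L.opens i) (s i)

/-- A line bundle `L` on a variety (an integral scheme) is effective, in the sense of its class in
`Pic ⊗ ℝ`, if some power `L^m`, `m > 0`, has a nonzero global
section. The zero divisors of the nonzero sections of `L^m` are precisely the effective Cartier
divisors in the class `m [L]`; hence this says that a positive multiple of `[L]` is the class of an
effective divisor, that is, that `[L]` lies in the cone in `Pic ⊗ ℝ` generated by the classes of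
effective divisors. -/
def IsEffective (L : LineBundle X) : Prop :=
  ∃ m : ℕ, 0 < m ∧ ∃ s : ∀ i, Γ(X, (L.pow m).opens i), (L.pow m).IsSection s ∧ s ≠ 0

end LineBundle

end LineBundle

section CartierDivisor

variable {N : Type u} [AddCommGroup N] (Δ : Fan N) (k : Type u) [Field k]

/-- The identification of `k[τ^∨ ∩ M]` with the ring of functions on `U_τ`. -/
def Fan.chartFun (τ : Δ.Cone) : CoordRing k τ.1 →+* Γ(Δ.toricVariety k, Δ.chartOpen k τ) :=
  (res _ (Δ.chart k τ).image_top_eq_opensRange.ge).comp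
    (((Δ.chart k τ).appIso ⊤).inv.hom.comp (Scheme.ΓSpecIso (.of (CoordRing k τ.1))).inv.hom)

theorem Fan.top_le_preimage (τ : Δ.Cone) : ⊤ ≤ Δ.chart k τ ⁻¹ᵁ Δ.chartOpen k τ :=
  (Scheme.Hom.preimage_opensRange _).ge

theorem Fan.appLE_chartFun (τ : Δ.Cone) (f : CoordRing k τ.1) :
    ((Δ.chart k τ).appLE (Δ.chartOpen k τ) ⊤ (Δ.top_le_preimage k τ)).hom (Δ.chartFun k τ f) =
      (Scheme.ΓSpecIso (.of (CoordRing k τ.1))).inv.hom f := by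
  have h : ((Δ.chart k τ).appIso ⊤).inv ≫ (Δ.toricVariety k).presheaf.map
      (homOfLE (Δ.chart k τ).image_top_eq_opensRange.ge).op ≫
      (Δ.chart k τ).appLE (Δ.chartOpen k τ) ⊤ (Δ.top_le_preimage k τ) = 𝟙 _ := by
    rw [Scheme.Hom.map_appLE, Scheme.Hom.appIso_inv_appLE]
    exact (Spec (.of (CoordRing k τ.1))).presheaf.map_id _
  exact ConcreteCategory.congr_hom h ((Scheme.ΓSpecIso (.of (CoordRing k τ.1))).inv.hom f)

theorem Fan.res_chartFun {ρ τ : Δ.Cone} (h : ρ ≤ τ) (f : CoordRing k τ.1) :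
    res _ (Δ.chartOpen_mono k h) (Δ.chartFun k τ f) = Δ.chartFun k ρ (coordMap k h f) := by
  have hinj : Function.Injective
      ((Δ.chart k ρ).appLE (Δ.chartOpen k ρ) ⊤ (Δ.top_le_preimage k ρ)).hom := by
    have : (Δ.chart k ρ).appLE (Δ.chartOpen k ρ) ⊤ (Δ.top_le_preimage k ρ) =
        (Δ.toricVariety k).presheaf.map
          (homOfLE (Δ.chart k ρ).image_top_eq_opensRange.le).op ≫
          ((Δ.chart k ρ).appIso ⊤).hom := by
      rw [Scheme.Hom.appIso_hom', Scheme.Hom.map_appLE]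
    rw [this]
    have : IsIso (homOfLE (Δ.chart k ρ).image_top_eq_opensRange.le) :=
      ⟨homOfLE (Δ.chart k ρ).image_top_eq_opensRange.ge, rfl, rfl⟩
    have h1 : IsIso ((Δ.toricVariety k).presheaf.map
        (homOfLE (Δ.chart k ρ).image_top_eq_opensRange.le).op) := inferInstance
    have h2 : IsIso ((Δ.toricVariety k).presheaf.map
        (homOfLE (Δ.chart k ρ).image_top_eq_opensRange.le).op ≫
          ((Δ.chart k ρ).appIso ⊤).hom) := @IsIso.comp_isIso _ _ _ _ _ _ _ h1 inferInstance
    exact (@ConcreteCategory.bijective_of_isIso CommRingCat _ _ _ _ _ _ _ _ h2).1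
  apply hinj
  rw [Δ.appLE_chartFun]
  have h1 : (Δ.toricVariety k).presheaf.map (homOfLE (Δ.chartOpen_mono k h)).op ≫
      (Δ.chart k ρ).appLE (Δ.chartOpen k ρ) ⊤ (Δ.top_le_preimage k ρ) =
      (Δ.chart k τ).appLE (Δ.chartOpen k τ) ⊤ (Δ.top_le_preimage k τ) ≫
        (Spec.map (CommRingCat.ofHom (coordMap k h))).appTop := by
    have ht : (Spec.map (CommRingCat.ofHom (coordMap k h))).appTop =
        (Spec.map (CommRingCat.ofHom (coordMap k h))).appLE ⊤ ⊤
          (Scheme.Hom.preimage_top (f := Spec.map (CommRingCat.ofHom (coordMap k h)))).ge :=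
      Scheme.Hom.app_eq_appLE _
    rw [ht, Scheme.Hom.map_appLE, Scheme.Hom.appLE_comp_appLE]
    simp only [Δ.map_chart k h]
  have h2 := ConcreteCategory.congr_hom h1 (Δ.chartFun k τ f)
  have h3 := ConcreteCategory.congr_hom
    (Scheme.ΓSpecIso_inv_naturality (CommRingCat.ofHom (coordMap k h))) f
  refine h2.trans (Eq.trans ?_ h3.symm)
  exact congrArg (Spec.map (CommRingCat.ofHom (coordMap k h))).appTop (Δ.appLE_chartFun k τ f)

/-- A torus-invariant Cartier divisor on the toric variety of `Δ`: the local equation on `U_τ` is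
the character `χ^{-u(τ)}`, where `u(τ) - u(ρ)` vanishes on `ρ` for every face `ρ` of `τ`, so that the
local equations differ by units on the overlaps. -/
structure CartierDivisor where
  localForm : Δ.Cone → DualLattice N
  compat : ∀ ρ τ : Δ.Cone, ρ ≤ τ → ∀ x ∈ ρ.1, pair (localForm τ) x = pair (localForm ρ) x

/-- The unit `χ^u` of `k[τ^∨ ∩ M]`, for `u` vanishing on `τ`. -/
def characterUnit {τ : PointedCone ℝ (RealSpace N)} (u : DualLattice N)
    (hu : ∀ x ∈ τ, pair u x = 0) : (CoordRing k τ)ˣ where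
  val := character k ⟨u, fun x hx => (hu x hx).ge⟩
  inv := character k ⟨-u, fun x hx => by rw [pair_neg, hu x hx, neg_zero]⟩
  val_inv := by
    rw [character_mul, ← character_zero]; congr 1; ext1; simp
  inv_val := by
    rw [character_mul, ← character_zero]; congr 1; ext1; simp

variable {Δ}

theorem CartierDivisor.sub_eq_zero (D : CartierDivisor Δ) (τ τ' ρ : Δ.Cone) (h : ρ ≤ τ)
    (h' : ρ ≤ τ') : ∀ x ∈ ρ.1, pair (D.localForm τ - D.localForm τ') x = 0 := fun x hx => by
  rw [pair_sub, D.compat ρ τ h x hx, D.compat ρ τ' h' x hx, sub_self]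

/-- The line bundle `O(D)`: it is generated by `χ^{u(τ)}` on `U_τ`, so that the transition functions
are `χ^{u(τ) - u(τ')}`. -/
def CartierDivisor.lineBundle (D : CartierDivisor Δ) : LineBundle (Δ.toricVariety k) where
  index := Δ.Cone
  opens := Δ.chartOpen k
  iSup_opens := Δ.iSup_chartOpen k
  trans τ τ' := Units.map
    ((res _ (Δ.inf_chartOpen_le k τ τ')).comp (Δ.chartFun k (Δ.meet τ τ'))).toMonoidHom
    (characterUnit k (D.localForm τ - D.localForm τ')
      (D.sub_eq_zero τ τ' _ (Δ.meet_le_left τ τ') (Δ.meet_le_right τ τ')))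
  cocycle τ₁ τ₂ τ₃ := by
    let π := Δ.meet (Δ.meet τ₁ τ₂) τ₃
    have hW : Δ.chartOpen k τ₁ ⊓ Δ.chartOpen k τ₂ ⊓ Δ.chartOpen k τ₃ ≤ Δ.chartOpen k π :=
      (inf_le_inf_right _ (Δ.inf_chartOpen_le k τ₁ τ₂)).trans (Δ.inf_chartOpen_le k _ _)
    have key : ∀ (ρ : Δ.Cone) (hρ : π ≤ ρ)
        (h : Δ.chartOpen k τ₁ ⊓ Δ.chartOpen k τ₂ ⊓ Δ.chartOpen k τ₃ ≤ Δ.chartOpen k ρ)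
        (f : CoordRing k ρ.1), res _ h (Δ.chartFun k ρ f) =
          res _ hW (Δ.chartFun k π (coordMap k hρ f)) := by
      intro ρ hρ h f
      rw [← Δ.res_chartFun k hρ, res_res]
    have h12 : π ≤ Δ.meet τ₁ τ₂ := Δ.meet_le_left _ _
    have h1 : π ≤ τ₁ := h12.trans (Δ.meet_le_left _ _)
    have h2 : π ≤ τ₂ := h12.trans (Δ.meet_le_right _ _)
    have h3 : π ≤ τ₃ := Δ.meet_le_right _ _
    have h23 : π ≤ Δ.meet τ₂ τ₃ := show π.1 ≤ τ₂.1 ⊓ τ₃.1 from le_inf h2 h3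
    have h13 : π ≤ Δ.meet τ₁ τ₃ := show π.1 ≤ τ₁.1 ⊓ τ₃.1 from le_inf h1 h3
    simp only [Units.coe_map, RingHom.toMonoidHom_eq_coe, MonoidHom.coe_coe, RingHom.comp_apply,
      res_res, characterUnit]
    rw [key _ h12, key _ h23, key _ h13, ← map_mul, ← map_mul, coordMap_character,
      coordMap_character, coordMap_character, character_mul]
    congr 4
    ext1
    exact sub_add_sub_cancel _ _ _

theorem CartierDivisor.localForm_eq (D : CartierDivisor Δ) {τ τ' : Δ.Cone} {x : RealSpace N}
    (h : x ∈ τ.1) (h' : x ∈ τ'.1) : pair (D.localForm τ) x = pair (D.localForm τ') x := by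
  have hx : x ∈ (Δ.meet τ τ').1 := Submodule.mem_inf.2 ⟨h, h'⟩
  rw [D.compat _ τ (Δ.meet_le_left τ τ') x hx, D.compat _ τ' (Δ.meet_le_right τ τ') x hx]

/-- The fan `star¹(σ)`: the cone `σ` and the cones of dimension `dim σ + 1` of the fan that contain
`σ`, together with all faces of these cones. -/
def Fan.starOne (Δ : Fan N) (σ : Δ.Cone) : Set Δ.Cone :=
  {ρ | ∃ τ : Δ.Cone, σ ≤ τ ∧ (τ = σ ∨ coneDim τ.1 = coneDim σ.1 + 1) ∧ ρ ≤ τ}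

open Classical in
/-- The piecewise linear function `ψ_D` on the support of the fan with `ψ_D = -⟨u(τ), ·⟩` on every
cone `τ`; it is linear on the cones and has the value `a_i` at `v_i`. (It is given the value `0`
outside the support.) -/
def CartierDivisor.psi (D : CartierDivisor Δ) (x : RealSpace N) : ℝ :=
  if h : ∃ τ : Δ.Cone, x ∈ τ.1 then -pair (D.localForm h.choose) x else 0

theorem CartierDivisor.psi_eq (D : CartierDivisor Δ) {τ : Δ.Cone} {x : RealSpace N}
    (hx : x ∈ τ.1) : D.psi x = -pair (D.localForm τ) x := by
  have h : ∃ τ : Δ.Cone, x ∈ τ.1 := ⟨τ, hx⟩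
  rw [CartierDivisor.psi, dif_pos h, D.localForm_eq h.choose_spec hx]

/-- Convexity on `star¹(σ)` of a function on the support of the fan. -/
def ConvexOnStarOne (σ : Δ.Cone) (ψ : RealSpace N → ℝ) : Prop :=
  ∀ (l : ℕ) (x : Fin l → RealSpace N), (∀ j, ∃ ρ ∈ Δ.starOne σ, x j ∈ ρ.1) →
    ∑ j, x j ∈ σ.1 → ψ (∑ j, x j) ≤ ∑ j, ψ (x j)

/-- The rays of the fan. For a cone `σ` of the fan, the ray `i` is a ray of `σ` if and only if
`i ≤ σ`. -/
abbrev Fan.Ray (Δ : Fan N) : Type u := {ρ : Δ.Cone // coneDim ρ.1 = 1}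

instance : Fintype Δ.Ray := Fintype.ofFinite _

variable [Module.Free ℤ N]

theorem Fan.exists_firstLatticePoint (Δ : Fan N) (i : Δ.Ray) :
    ∃ v : N, v ≠ 0 ∧ latticeVec v ∈ i.1.1 ∧
      ∀ w : N, latticeVec w ∈ i.1.1 → ∃ n : ℕ, w = n • v := by
  obtain ⟨⟨ρ, hρ⟩, hdim⟩ := i
  change coneDim ρ = 1 at hdim
  change ∃ v : N, v ≠ 0 ∧ latticeVec v ∈ ρ ∧ ∀ w : N, latticeVec w ∈ ρ → ∃ n : ℕ, w = n • v
  have hsc := Δ.stronglyConvex ρ hρ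
  obtain ⟨s, hs, hs0⟩ : ∃ s : N, latticeVec s ∈ ρ ∧ latticeVec s ≠ 0 := by
    by_contra! hcon
    obtain ⟨S, hS⟩ := Δ.rational ρ hρ
    have : (ρ : Set (RealSpace N)) ⊆ {0} := by
      have : ρ ≤ ⊥ := by
        conv_lhs => rw [hS]
        rw [Submodule.span_le]
        rintro _ ⟨t, ht, rfl⟩
        refine (Submodule.mem_bot _).2 (hcon t ?_)
        rw [hS]
        exact Submodule.subset_span ⟨t, ht, rfl⟩
      intro x hx
      exact (Submodule.mem_bot _).1 (this hx)
    have h0 : Submodule.span ℝ (ρ : Set (RealSpace N)) = ⊥ :=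
      Submodule.span_eq_bot.2 fun x hx => this hx
    rw [coneDim, h0, finrank_bot] at hdim
    exact absurd hdim (by norm_num)
  have hmul : ∀ x ∈ ρ, ∃ r : ℝ, 0 ≤ r ∧ r • latticeVec s = x := by
    intro x hx
    obtain ⟨r, hr⟩ := exists_smul_eq_of_finrank_eq_one
      (K := ℝ) (V := Submodule.span ℝ (ρ : Set (RealSpace N))) hdim
      (x := ⟨latticeVec s, Submodule.subset_span hs⟩)
      (fun h => hs0 (congrArg Subtype.val h)) ⟨x, Submodule.subset_span hx⟩
    have hr' : r • latticeVec s = x := congrArg Subtype.val hr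
    refine ⟨r, ?_, hr'⟩
    by_contra! hneg
    refine hs0 (hsc _ hs ?_)
    have := PointedCone.smul_mem ρ (r := (-r)⁻¹) (by rw [inv_nonneg]; linarith) hx
    rwa [← hr', smul_smul, inv_neg, neg_mul, inv_mul_cancel₀ hneg.ne, neg_smul, one_smul] at this
  have hs' : s ≠ 0 := by
    rintro rfl
    exact hs0 (by simp [latticeVec])
  obtain ⟨u, hu⟩ : ∃ u : DualLattice N, 0 < u s := by
    obtain ⟨u, hu⟩ : ∃ u : DualLattice N, u s ≠ 0 := by
      by_contra! hcon
      exact hs' ((Module.forall_dual_apply_eq_zero_iff ℤ s).1 hcon)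
    rcases hu.lt_or_gt with h | h
    · exact ⟨-u, by simpa using h⟩
    · exact ⟨u, h⟩
  have hposR : (0 : ℝ) < u s := by exact_mod_cast hu
  have hinj : ∀ w : N, (latticeVec w : RealSpace N) = 0 → w = 0 := by
    intro w hw
    refine (Module.forall_dual_apply_eq_zero_iff ℤ w).1 fun f => ?_
    have := pair_latticeVec f w
    rw [hw, map_zero] at this
    exact_mod_cast this.symm
  have hpos : ∀ w : N, latticeVec w ∈ ρ → w ≠ 0 → 0 < u w := by
    intro w hw hw0
    obtain ⟨r, hr, hrw⟩ := hmul _ hw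
    have h1 := pair_latticeVec u w
    rw [← hrw, map_smul, pair_latticeVec, smul_eq_mul] at h1
    have hr0 : r ≠ 0 := by
      rintro rfl
      exact hw0 (hinj w (by rw [← hrw, zero_smul]))
    have : (0 : ℝ) < u w := by
      rw [← h1]; exact mul_pos (lt_of_le_of_ne hr hr0.symm) hposR
    exact_mod_cast this
  classical
  have hex : ∃ n : ℕ, ∃ v : N, v ≠ 0 ∧ latticeVec v ∈ ρ ∧ u v = n :=
    ⟨(u s).toNat, s, hs', hs, by omega⟩
  obtain ⟨v, hv0, hv, hvn⟩ := Nat.find_spec hex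
  refine ⟨v, hv0, hv, fun w hw => ?_⟩
  obtain ⟨r, hr, hrw⟩ := hmul _ hw
  obtain ⟨t, ht, htv⟩ := hmul _ hv
  have ht0 : 0 < t := by
    refine lt_of_le_of_ne ht ?_
    rintro rfl
    exact hv0 (hinj v (by rw [← htv, zero_smul]))
  have hw' : latticeVec w = (r / t) • latticeVec v := by
    rw [← hrw, ← htv, smul_smul, div_mul_cancel₀ _ ht0.ne']
  refine ⟨⌊r / t⌋₊, ?_⟩
  by_contra hne
  have hrt : 0 ≤ r / t := div_nonneg hr ht
  have hdiff : latticeVec (w - ⌊r / t⌋₊ • v) = (r / t - ⌊r / t⌋₊) • latticeVec v := by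
    rw [sub_smul, ← hw', latticeVec, TensorProduct.tmul_sub, TensorProduct.tmul_smul,
      Nat.cast_smul_eq_nsmul]
    rfl
  have hmem : latticeVec (w - ⌊r / t⌋₊ • v) ∈ ρ := by
    rw [hdiff]
    exact PointedCone.smul_mem ρ (sub_nonneg.2 (Nat.floor_le hrt)) hv
  have hp := hpos _ hmem (sub_ne_zero.2 hne)
  have hlt : u (w - ⌊r / t⌋₊ • v) < u v := by
    have h1 := pair_latticeVec u (w - ⌊r / t⌋₊ • v)
    rw [hdiff, map_smul, pair_latticeVec, smul_eq_mul] at h1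
    have h2 : (0 : ℝ) < u v := by exact_mod_cast hpos v hv hv0
    have h3 := Nat.lt_floor_add_one (r / t)
    have : ((u (w - ⌊r / t⌋₊ • v) : ℤ) : ℝ) < u v := by
      rw [← h1]; nlinarith
    exact_mod_cast this
  refine Nat.find_min hex (m := (u (w - ⌊r / t⌋₊ • v)).toNat) (by omega)
    ⟨_, sub_ne_zero.2 hne, hmem, by omega⟩

/-- The first lattice point `v_i` on the ray `i`. -/
def Fan.rayVec (Δ : Fan N) (i : Δ.Ray) : N := (Δ.exists_firstLatticePoint i).choose

theorem Fan.rayVec_mem (Δ : Fan N) (i : Δ.Ray) : latticeVec (Δ.rayVec i) ∈ i.1.1 :=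
  (Δ.exists_firstLatticePoint i).choose_spec.2.1

/-- The coefficients `a_i` in `D = ∑ a_i D_i`. The order of vanishing of `χ^u` along the prime
divisor `D_i` of the ray `i` is `⟨u, v_i⟩`. -/
def CartierDivisor.coeff (D : CartierDivisor Δ) (i : Δ.Ray) : ℤ :=
  -D.localForm i.1 (Δ.rayVec i)

theorem CartierDivisor.localForm_rayVec (D : CartierDivisor Δ) {i : Δ.Ray} {τ : Δ.Cone}
    (h : i.1 ≤ τ) : D.localForm τ (Δ.rayVec i) = -D.coeff i := by
  have := D.compat i.1 τ h _ (Δ.rayVec_mem i)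
  rw [pair_latticeVec, pair_latticeVec] at this
  rw [CartierDivisor.coeff, neg_neg]
  exact_mod_cast this

/-- The divisor `div(χ^u) = ∑ ⟨u, v_i⟩ D_i`, with coefficients in `ℝ`. -/
def divCharacter (Δ : Fan N) (u : DualLattice N) : Δ.Ray → ℝ := fun i => u (Δ.rayVec i)

/-- Equality of the classes of two torus-invariant divisors with real coefficients: the difference
is a real linear combination of divisors of characters. -/
def LinearlyEquivalent (Δ : Fan N) (a a' : Δ.Ray → ℝ) : Prop :=
  a' - a ∈ Submodule.span ℝ (Set.range (divCharacter Δ))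

theorem CartierDivisor.psi_rayVec (D : CartierDivisor Δ) (i : Δ.Ray) :
    D.psi (latticeVec (Δ.rayVec i)) = D.coeff i := by
  rw [D.psi_eq (Δ.rayVec_mem i), pair_latticeVec, CartierDivisor.coeff, Int.cast_neg]

end CartierDivisor

end Toric

end

/-! All four conditions are tied to one criterion (∗): there are `m > 0` and a lattice form `w` such
that, for every `τ ⊇ σ`, the form `w - m • u(τ)` vanishes on `σ` and is nonnegative on `τ`.

Effectivity is equivalent to (∗) because sections are graded by characters. The orbit closure `V(σ)`
meets only the charts `U_τ` with `τ ⊇ σ`; functions on `V(σ) ∩ U_τ` are Laurent polynomials with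
exponents in `τ^∨ ∩ σ^⊥ ∩ M`, and the pullback of `O(mD)` has transition functions `χ^{m(u(τ) -
u(τ'))}`. A single exponent of a nonzero section, shifted by `m • u(τ₀)`, is the required `w`
(`CartierDivisor.exists_form_of_isEffective`); conversely the characters `χ^{w - m u(τ)}` glue to a
nonzero section (`CartierDivisor.isEffective_of_form`).

From (∗), the divisor with coefficients `a_i + ⟨w, v_i⟩ / m` is as required in the second condition.
Such a divisor comes from a real linear form `l` with `-l ≤ ψ_D` on `star¹(σ)` and equality on `σ`,
whence convexity. Convexity applied to the positive part of a relation between the rays gives the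
inequality of the fourth condition.

The way back from the fourth condition to (∗) is Farkas' lemma. It is applied over `ℚ`, so that
denominators can be cleared and `w` is a lattice form. It only controls the rays of `star¹(σ)`; that
this suffices for all `τ ⊇ σ` is `nonneg_of_nonneg_on_next_faces`: modulo the span of `σ`, the cone
`τ` is generated by its faces of dimension `dim σ + 1` containing `σ`. -/

noncomputable section

namespace Toric

open CategoryTheory CategoryTheory.Limits AlgebraicGeometry TopologicalSpace Opposite
open scoped TensorProduct

/-! ### Farkas' lemma over ordered fields and for lattices -/

section Farkas

/-- **Farkas' lemma** for finitely many linear forms on a vector space over an ordered field. -/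
theorem exists_nonneg_sum_smul_eq {F V ι : Type*} [Field F] [LinearOrder F] [IsStrictOrderedRing F]
    [AddCommGroup V] [Module F V] (s : Finset ι) (a : ι → V →ₗ[F] F) (b : V →ₗ[F] F)
    (h : ∀ x, (∀ i ∈ s, 0 ≤ a i x) → 0 ≤ b x) :
    ∃ c : ι → F, (∀ i, 0 ≤ c i) ∧ b = ∑ i ∈ s, c i • a i := by
  classical
  induction s using Finset.induction_on generalizing a b with
  | empty =>
    refine ⟨0, fun _ => le_rfl, LinearMap.ext fun x => ?_⟩
    have h1 := h x (by simp)
    have h2 := h (-x) (by simp)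
    rw [map_neg] at h2
    simp only [Finset.sum_empty, LinearMap.zero_apply]
    linarith
  | insert j s hj ih =>
    by_cases hb : ∀ x, (∀ i ∈ s, 0 ≤ a i x) → 0 ≤ b x
    · obtain ⟨c, hc, hbc⟩ := ih a b hb
      refine ⟨Function.update c j 0, fun i => ?_, ?_⟩
      · by_cases hij : i = j
        · simp [hij]
        · simpa [hij] using hc i
      · rw [Finset.sum_insert hj, hbc]
        simp only [Function.update_self, zero_smul, zero_add]
        refine Finset.sum_congr rfl fun i hi => ?_
        rw [Function.update_of_ne (by rintro rfl; exact hj hi)]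
    · push Not at hb
      obtain ⟨x₁, hx₁, hbx₁⟩ := hb
      have haj : a j x₁ < 0 := by
        by_contra! hcon
        refine absurd (h x₁ fun i hi => ?_) (not_le.2 hbx₁)
        rcases Finset.mem_insert.1 hi with rfl | hi
        · exact hcon
        · exact hx₁ i hi
      -- The hypothesis forces `a j x₁ < 0`, so `x₁` can be rescaled. Then `x ↦ x + a j x • x₀` is
      -- the projection onto the kernel of `a j` along `x₀`.
      obtain ⟨x₀, hx₀, hbx₀, hj₀⟩ : ∃ x₀, (∀ i ∈ s, 0 ≤ a i x₀) ∧ b x₀ < 0 ∧ a j x₀ = -1 := by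
        have hpos : 0 < (-a j x₁)⁻¹ := inv_pos.2 (by linarith)
        refine ⟨(-a j x₁)⁻¹ • x₁, fun i hi => ?_, ?_, ?_⟩
        · rw [map_smul, smul_eq_mul]
          exact mul_nonneg hpos.le (hx₁ i hi)
        · rw [map_smul, smul_eq_mul]
          exact mul_neg_of_pos_of_neg hpos hbx₁
        · rw [map_smul, smul_eq_mul, inv_neg, neg_mul, inv_mul_cancel₀ haj.ne]
      -- The induction hypothesis is applied to the forms composed with this projection. Solving the
      -- resulting identity for `b` gives `a j` the coefficient `∑ c i * a i x₀ - b x₀`, which is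
      -- nonnegative because `b x₀ < 0`.
      obtain ⟨c, hc, hbc⟩ := ih (fun i => a i + a i x₀ • a j) (b + b x₀ • a j) (by
        intro x hx
        have := h (x + a j x • x₀) (by
          intro i hi
          rcases Finset.mem_insert.1 hi with rfl | hi
          · rw [map_add, map_smul, hj₀, smul_eq_mul]
            linarith
          · have := hx i hi
            simp only [LinearMap.add_apply, LinearMap.smul_apply, smul_eq_mul] at this
            rw [map_add, map_smul, smul_eq_mul]
            linarith)
        simp only [LinearMap.add_apply, LinearMap.smul_apply, smul_eq_mul]
        rw [map_add, map_smul, smul_eq_mul] at this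
        linarith)
      refine ⟨Function.update c j (∑ i ∈ s, c i * a i x₀ - b x₀), fun i => ?_, ?_⟩
      · by_cases hij : i = j
        · subst hij
          rw [Function.update_self]
          have := Finset.sum_nonneg fun i hi => mul_nonneg (hc i) (hx₀ i hi)
          linarith
        · simpa [hij] using hc i
      · rw [Finset.sum_insert hj, Function.update_self]
        have h1 : ∑ i ∈ s, Function.update c j (∑ i ∈ s, c i * a i x₀ - b x₀) i • a i =
            ∑ i ∈ s, c i • a i := by
          refine Finset.sum_congr rfl fun i hi => ?_
          rw [Function.update_of_ne (by rintro rfl; exact hj hi)]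
        rw [h1]
        refine (eq_sub_of_add_eq hbc).trans ?_
        ext x
        simp only [LinearMap.sub_apply, LinearMap.add_apply, LinearMap.smul_apply,
          LinearMap.sum_apply, smul_eq_mul, mul_add, Finset.sum_add_distrib, sub_mul,
          Finset.sum_mul, mul_assoc]
        ring

/-- Farkas' lemma for lattices: either some lattice form is nonnegative on finitely many given
lattice vectors and negative on `t`, or `t` is a nonnegative rational combination of them. -/
theorem exists_form_neg_or_nonneg_sum {N ι : Type*} [AddCommGroup N] [Module.Free ℤ N]
    [Module.Finite ℤ N] (s : Finset ι) (v : ι → N) (t : N) :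
    (∃ u : N →ₗ[ℤ] ℤ, (∀ i ∈ s, 0 ≤ u (v i)) ∧ u t < 0) ∨
      ∃ c : ι → ℝ, (∀ i, 0 ≤ c i) ∧ ∀ u : N →ₗ[ℤ] ℤ, (u t : ℝ) = ∑ i ∈ s, c i * u (v i) := by
  -- Lattice vectors are turned into linear forms on `Hom(N, ℚ)`, so that a violation of the
  -- hypothesis of Farkas' lemma is a rational form on `N`.
  let ev : N → (N →ₗ[ℤ] ℚ) →ₗ[ℚ] ℚ := fun x =>
    { toFun := fun f => f x, map_add' := fun _ _ => rfl, map_smul' := fun _ _ => rfl }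
  by_cases h : ∀ f : N →ₗ[ℤ] ℚ, (∀ i ∈ s, 0 ≤ ev (v i) f) → 0 ≤ ev t f
  · right
    obtain ⟨c, hc, hct⟩ := exists_nonneg_sum_smul_eq s (fun i => ev (v i)) (ev t) h
    refine ⟨fun i => c i, fun i => Rat.cast_nonneg.2 (hc i), fun u => ?_⟩
    have := LinearMap.congr_fun hct ((Algebra.linearMap ℤ ℚ).comp u)
    simp only [LinearMap.sum_apply, LinearMap.smul_apply, smul_eq_mul] at this
    change ((u t : ℤ) : ℚ) = ∑ i ∈ s, c i * ((u (v i) : ℤ) : ℚ) at this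
    have := congrArg (fun q : ℚ => (q : ℝ)) this
    push_cast at this
    exact this
  · left
    push Not at h
    obtain ⟨f, hf, hft⟩ := h
    let B := Module.Free.chooseBasis ℤ N
    obtain ⟨d, hd⟩ := IsLocalization.exist_integer_multiples (nonZeroDivisors ℤ) Finset.univ
      (fun j => f (B j))
    choose g hg using fun j => hd j (Finset.mem_univ j)
    have hd0 : (d : ℤ) ≠ 0 := nonZeroDivisors.ne_zero d.2
    -- The common denominator `d` may be negative; multiplying by it twice gives `d ^ 2 • f`, which
    -- has the signs of `f`.
    let w : N →ₗ[ℤ] ℤ := (d : ℤ) • B.constr ℤ g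
    have hw : ∀ x, ((w x : ℤ) : ℚ) = ((d : ℤ) : ℚ) ^ 2 * f x := by
      have : (Algebra.linearMap ℤ ℚ).comp w = ((d : ℤ) ^ 2) • f := by
        refine B.ext fun j => ?_
        have hj : ((g j : ℤ) : ℚ) = (d : ℤ) • f (B j) := hg j
        simp only [w, LinearMap.comp_apply, LinearMap.smul_apply, Module.Basis.constr_basis,
          Algebra.linearMap_apply, eq_intCast, smul_eq_mul, Int.cast_mul, hj, zsmul_eq_mul]
        push_cast
        ring
      intro x
      have := LinearMap.congr_fun this x
      simp only [LinearMap.comp_apply, LinearMap.smul_apply, Algebra.linearMap_apply, eq_intCast,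
        zsmul_eq_mul] at this
      rw [this]
      push_cast
      rfl
    have hd2 : (0 : ℚ) < ((d : ℤ) : ℚ) ^ 2 := by positivity
    refine ⟨w, fun i hi => ?_, ?_⟩
    · have : (0 : ℚ) ≤ w (v i) := by
        rw [hw]; exact mul_nonneg hd2.le (hf i hi)
      exact_mod_cast this
    · have : ((w t : ℤ) : ℚ) < 0 := by
        rw [hw]; exact mul_neg_of_pos_of_neg hd2 hft
      exact_mod_cast this

end Farkas

/-! ### Separation by lattice forms in `N ⊗ ℝ` -/

section Cones

variable {N : Type u} [AddCommGroup N]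

theorem latticeVec_neg (v : N) : (latticeVec (-v) : RealSpace N) = -latticeVec v := by
  rw [latticeVec, TensorProduct.tmul_neg]; rfl

/-- The lattice forms separate the points of `N ⊗ ℝ`. -/
theorem eq_of_forall_pair_eq [Module.Free ℤ N] [Module.Finite ℤ N] {x y : RealSpace N}
    (h : ∀ u : DualLattice N, pair u x = pair u y) : x = y := by
  let B := Module.Free.chooseBasis ℤ N
  let B' := B.baseChange ℝ
  refine B'.ext_elem fun j => ?_
  have key : ∀ z : RealSpace N, B'.repr z j = pair (B.coord j) z := by
    intro z
    have : B'.coord j = pair (B.coord j) := by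
      refine B'.ext fun i => ?_
      have : B' i = latticeVec (B i) := Module.Basis.baseChange_apply ..
      rw [Module.Basis.coord_apply, Module.Basis.repr_self, this, pair_latticeVec,
        Module.Basis.coord_apply, Module.Basis.repr_self]
      simp [Finsupp.single_apply]
    exact LinearMap.congr_fun this z
  rw [key, key, h]

/-- Either some lattice form is nonnegative on finitely many given lattice vectors and negative on
`t`, or `t` lies in the cone generated by them. -/
theorem exists_form_neg_or_mem_hull [Module.Free ℤ N] [Module.Finite ℤ N] (A : Finset N) (t : N) :
    (∃ u : DualLattice N, (∀ a ∈ A, 0 ≤ u a) ∧ u t < 0) ∨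
      latticeVec t ∈ PointedCone.hull ℝ (latticeVec '' (A : Set N)) := by
  rcases exists_form_neg_or_nonneg_sum A id t with h | ⟨c, hc, h⟩
  · exact .inl h
  · right
    have : latticeVec t = ∑ a ∈ A, c a • latticeVec a := by
      refine eq_of_forall_pair_eq fun u => ?_
      rw [pair_latticeVec, h, map_sum]
      simp [pair_latticeVec]
    rw [this]
    exact Submodule.sum_mem _ fun a ha => PointedCone.smul_mem _ (hc a)
      (Submodule.subset_span ⟨a, ha, rfl⟩)

theorem pair_sum {ι : Type*} (s : Finset ι) (u : ι → DualLattice N) (x : RealSpace N) :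
    pair (∑ i ∈ s, u i) x = ∑ i ∈ s, pair (u i) x := by
  classical
  induction s using Finset.induction_on with
  | empty => simp [pair_zero]
  | insert j s hj ih => rw [Finset.sum_insert hj, Finset.sum_insert hj, pair_add, ih]

/-- A linear form that is nonnegative on generators is nonnegative on the cone. -/
theorem nonneg_of_mem_hull {V : Type*} [AddCommGroup V] [Module ℝ V] (l : V →ₗ[ℝ] ℝ) {s : Set V}
    (h : ∀ x ∈ s, 0 ≤ l x) {x : V} (hx : x ∈ PointedCone.hull ℝ s) : 0 ≤ l x := by
  induction hx using Submodule.span_induction with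
  | mem x hx => exact h x hx
  | zero => simp
  | add x y _ _ hx hy => rw [map_add]; exact add_nonneg hx hy
  | smul a x _ hx =>
    have : l (a • x) = (a : ℝ) * l x := by rw [← smul_eq_mul, ← map_smul]; rfl
    rw [this]
    exact mul_nonneg a.2 hx

end Cones

/-! ### Faces of rational cones and nonnegativity of linear forms -/

section ConeFaces

variable {N : Type u} [AddCommGroup N] [Module.Free ℤ N]

theorem latticeVec_eq_zero_iff {v : N} : (latticeVec v : RealSpace N) = 0 ↔ v = 0 := by
  refine ⟨fun h => (Module.forall_dual_apply_eq_zero_iff ℤ v).1 fun f => ?_, ?_⟩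
  · have := pair_latticeVec f v
    rw [h, map_zero] at this
    exact_mod_cast this.symm
  · rintro rfl
    simp [latticeVec]

/-- A ray is generated by its first lattice point. -/
theorem Fan.exists_eq_smul_rayVec (Δ : Fan N) (i : Δ.Ray) {x : RealSpace N} (hx : x ∈ i.1.1) :
    ∃ r : ℝ, 0 ≤ r ∧ x = r • latticeVec (Δ.rayVec i) := by
  have hv := Δ.rayVec_mem i
  have hv0 : (latticeVec (Δ.rayVec i) : RealSpace N) ≠ 0 := fun h =>
    (Δ.exists_firstLatticePoint i).choose_spec.1 (latticeVec_eq_zero_iff.1 h)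
  obtain ⟨r, hr⟩ := exists_smul_eq_of_finrank_eq_one
    (K := ℝ) (V := Submodule.span ℝ (i.1.1 : Set (RealSpace N))) i.2
    (x := ⟨latticeVec (Δ.rayVec i), Submodule.subset_span hv⟩)
    (fun h => hv0 (congrArg Subtype.val h)) ⟨x, Submodule.subset_span hx⟩
  have hr' : r • latticeVec (Δ.rayVec i) = x := congrArg Subtype.val hr
  refine ⟨r, ?_, hr'.symm⟩
  by_contra! hneg
  refine hv0 (Δ.stronglyConvex i.1.1 i.1.2 _ hv ?_)
  have := PointedCone.smul_mem i.1.1 (r := (-r)⁻¹) (by rw [inv_nonneg]; linarith) hx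
  rwa [← hr', smul_smul, inv_neg, neg_mul, inv_mul_cancel₀ hneg.ne, neg_smul, one_smul] at this

variable [Module.Finite ℤ N]

/-- The zero cone is a face of every strongly convex rational polyhedral cone. -/
theorem isFace_bot {τ : PointedCone ℝ (RealSpace N)} (hτ : IsRationalPolyhedral τ)
    (hsc : ∀ x ∈ τ, -x ∈ τ → x = 0) : IsFace ⊥ τ := by
  classical
  obtain ⟨S, rfl⟩ := hτ
  have hmem : ∀ s ∈ S, latticeVec s ∈ PointedCone.hull ℝ (latticeVec '' (S : Set N)) :=
    fun s hs => Submodule.subset_span ⟨s, hs, rfl⟩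
  have key : ∀ s : N, ∃ u : DualLattice N, (∀ a ∈ S, 0 ≤ u a) ∧ (s ∈ S → s ≠ 0 → 0 < u s) := by
    intro s
    by_cases h : s ∈ S ∧ s ≠ 0
    -- Strong convexity excludes `-s` from the cone, so some form is nonnegative on `S` and positive
    -- at `s`. The sum of these forms over all `s` is positive at every nonzero generator and cuts
    -- out the zero face.
    · rcases exists_form_neg_or_mem_hull S (-s) with ⟨u, hu, hus⟩ | hs
      · rw [map_neg] at hus
        exact ⟨u, hu, fun _ _ => by omega⟩
      · rw [latticeVec_neg] at hs
        exact absurd (latticeVec_eq_zero_iff.1 (hsc _ (hmem s h.1) hs)) h.2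
    · exact ⟨0, fun _ _ => le_rfl, fun h1 h2 => absurd ⟨h1, h2⟩ h⟩
  choose u hu hpos using key
  have hnn : ∀ a ∈ S, 0 ≤ (∑ s ∈ S, u s) a := fun a ha => by
    rw [LinearMap.sum_apply]; exact Finset.sum_nonneg fun s _ => hu s a ha
  have hgen : ∀ x ∈ PointedCone.hull ℝ (latticeVec '' (S : Set N)),
      0 ≤ pair (∑ s ∈ S, u s) x ∧ (pair (∑ s ∈ S, u s) x = 0 → x = 0) := by
    intro x hx
    induction hx using Submodule.span_induction with
    | mem x hx =>
      obtain ⟨a, ha, rfl⟩ := hx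
      rw [pair_latticeVec]
      refine ⟨by exact_mod_cast hnn a ha, fun h0 => ?_⟩
      by_contra hne
      have ha0 : a ≠ 0 := fun h => hne (latticeVec_eq_zero_iff.2 h)
      have h1 : 0 < (∑ s ∈ S, u s) a := by
        rw [LinearMap.sum_apply]
        exact Finset.sum_pos' (fun s _ => hu s a ha) ⟨a, ha, hpos a ha ha0⟩
      rw [Int.cast_eq_zero] at h0
      omega
    | zero => simp
    | add x y _ _ hx hy =>
      rw [map_add]
      refine ⟨add_nonneg hx.1 hy.1, fun h0 => ?_⟩
      rw [hx.2 (by linarith [hx.1, hy.1]), hy.2 (by linarith [hx.1, hy.1]), add_zero]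
    | smul a x _ hx =>
      have : pair (∑ s ∈ S, u s) (a • x) = (a : ℝ) * pair (∑ s ∈ S, u s) x := by
        rw [← smul_eq_mul, ← map_smul]; rfl
      rw [this]
      refine ⟨mul_nonneg a.2 hx.1, fun h0 => ?_⟩
      rcases mul_eq_zero.1 h0 with h | h
      · rw [show a = 0 from Subtype.ext h, zero_smul]
      · rw [hx.2 h]; exact smul_zero (a : ℝ)
  refine ⟨∑ s ∈ S, u s, fun x hx => (hgen x hx).1, fun x => ⟨fun hx => ?_, fun hx => ?_⟩⟩
  · rw [(Submodule.mem_bot _).1 hx]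
    exact ⟨Submodule.zero_mem _, map_zero _⟩
  · exact (Submodule.mem_bot _).2 ((hgen x hx.1).2 hx.2)

/-- A linear form that vanishes on a face `σ` of `τ` and is nonnegative on the faces of `τ` of
dimension `dim σ + 1` that contain `σ` is nonnegative on `τ`. -/
theorem nonneg_of_nonneg_on_next_faces {σ τ : PointedCone ℝ (RealSpace N)}
    (hτ : IsRationalPolyhedral τ) (hσ : IsRationalPolyhedral σ) (hface : IsFace σ τ)
    (l : RealSpace N →ₗ[ℝ] ℝ) (h0 : ∀ x ∈ σ, l x = 0)
    (h : ∀ ρ, IsFace ρ τ → σ ≤ ρ → coneDim ρ = coneDim σ + 1 → ∀ x ∈ ρ, 0 ≤ l x)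
    {x : RealSpace N} (hx : x ∈ τ) : 0 ≤ l x := by
  classical
  obtain ⟨S, hS⟩ := hτ
  obtain ⟨S₀, hS₀⟩ := hσ
  obtain ⟨u, hu, huσ⟩ := hface
  let K : Submodule ℝ (RealSpace N) := Submodule.span ℝ (σ : Set (RealSpace N))
  -- Adjoining the whole span `K` of `σ` replaces passing to the quotient by `K`: the cones `C T`
  -- are preimages of cones in that quotient.
  let C : Finset N → PointedCone ℝ (RealSpace N) := fun T =>
    PointedCone.hull ℝ (latticeVec '' (T : Set N) ∪ (K : Set (RealSpace N)))
  have hKC : ∀ T, ∀ y ∈ K, y ∈ C T := fun T y hy => Submodule.subset_span (.inr hy)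
  have hTC : ∀ T : Finset N, ∀ t ∈ T, latticeVec t ∈ C T := fun T t ht =>
    Submodule.subset_span (.inl ⟨t, ht, rfl⟩)
  have hSτ : ∀ s ∈ S, latticeVec s ∈ τ := fun s hs => by
    rw [hS]; exact Submodule.subset_span ⟨s, hs, rfl⟩
  have hS₀σ : ∀ s ∈ S₀, latticeVec s ∈ σ := fun s hs => by
    rw [hS₀]; exact Submodule.subset_span ⟨s, hs, rfl⟩
  have hK0 : ∀ (w : RealSpace N →ₗ[ℝ] ℝ), (∀ y ∈ σ, w y = 0) → ∀ y ∈ K, w y = 0 := by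
    intro w hw y hy
    have : K ≤ LinearMap.ker w := Submodule.span_le.2 fun z hz => hw z hz
    exact this hy
  -- a minimal set of generators of `τ` modulo the span of `σ`
  obtain ⟨T, ⟨hTS, hTτ⟩, hmin⟩ : ∃ T : Finset N, (T ⊆ S ∧ τ ≤ C T) ∧
      ∀ t ∈ T, latticeVec t ∉ C (T.erase t) := by
    obtain ⟨T, hT, hmin⟩ := (S.powerset.filter fun T => τ ≤ C T).exists_min_image Finset.card
      ⟨S, Finset.mem_filter.2 ⟨Finset.mem_powerset_self S, by
        rw [hS]; exact Submodule.span_mono Set.subset_union_left⟩⟩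
    rw [Finset.mem_filter, Finset.mem_powerset] at hT
    refine ⟨T, hT, fun t ht hcon => ?_⟩
    have hle : C T ≤ C (T.erase t) := by
      refine Submodule.span_le.2 ?_
      rintro _ (⟨t', ht', rfl⟩ | hy)
      · by_cases htt : t' = t
        · rw [htt]; exact hcon
        · exact hTC _ _ (Finset.mem_erase.2 ⟨htt, ht'⟩)
      · exact hKC _ _ hy
    have := hmin (T.erase t) (Finset.mem_filter.2 ⟨Finset.mem_powerset.2
      ((Finset.erase_subset _ _).trans hT.1), hT.2.trans hle⟩)
    exact absurd this (not_le.2 (Finset.card_erase_lt_of_mem ht))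
  have huC : ∀ T' ⊆ S, ∀ y ∈ C T', 0 ≤ pair u y := by
    intro T' hT' y hy
    refine nonneg_of_mem_hull _ ?_ hy
    rintro _ (⟨t', ht', rfl⟩ | hz)
    · exact hu _ (hSτ _ (hT' ht'))
    · exact (hK0 (pair u) (fun y hy => ((huσ y).1 hy).2) _ hz).ge
  -- A generator on which `u` vanishes lies in `σ`, hence in `K`, and minimality of `T` would have
  -- discarded it.
  have hupos : ∀ t ∈ T, 0 < pair u (latticeVec t) := by
    intro t ht
    refine lt_of_le_of_ne (hu _ (hSτ _ (hTS ht))) fun h => hmin t ht (hKC _ _ ?_)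
    exact Submodule.subset_span ((huσ _).2 ⟨hSτ _ (hTS ht), h.symm⟩)
  -- every `t ∈ T` spans, together with `σ`, a face
  have hlT : ∀ t ∈ T, 0 ≤ l (latticeVec t) := by
    intro t ht
    have key : ∀ t' : N, ∃ w : DualLattice N, (∀ y ∈ σ, pair w y = 0) ∧ w t = 0 ∧
        (∀ r ∈ T.erase t, 0 ≤ w r) ∧ (t' ∈ T.erase t → 0 < w t') := by
      intro t'
      by_cases ht' : t' ∈ T.erase t
      swap
      · exact ⟨0, fun _ _ => pair_zero _, rfl, fun _ _ => le_rfl, fun h => absurd h ht'⟩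
      -- Including both signs of `t` and of the generators of `σ` forces the separating form to
      -- vanish on them.
      rcases exists_form_neg_or_mem_hull
        ((T.erase t ∪ {t, -t}) ∪ (S₀ ∪ S₀.image fun s => -s)) (-t') with ⟨w, hw, hwt⟩ | hcon
      · refine ⟨w, fun y hy => ?_, ?_, fun r hr => hw r ?_, fun _ => ?_⟩
        · have h1 : 0 ≤ pair w y := by
            rw [hS₀] at hy
            refine nonneg_of_mem_hull _ ?_ hy
            rintro _ ⟨s, hs, rfl⟩
            rw [pair_latticeVec]
            have hs' : s ∈ S₀ := hs
            exact_mod_cast hw s (by simp [hs'])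
          have h2 : 0 ≤ (-pair w) y := by
            rw [hS₀] at hy
            refine nonneg_of_mem_hull _ ?_ hy
            rintro _ ⟨s, hs, rfl⟩
            have hs' : s ∈ S₀ := hs
            have := hw (-s) (by simp [hs'])
            rw [map_neg] at this
            rw [LinearMap.neg_apply, pair_latticeVec]
            exact_mod_cast this
          rw [LinearMap.neg_apply] at h2
          linarith
        · have h1 := hw t (by simp)
          have h2 := hw (-t) (by simp)
          rw [map_neg] at h2
          omega
        · exact Finset.mem_union_left _ (Finset.mem_union_left _ hr)
        · rw [map_neg] at hwt
          omega
      · exfalso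
        -- Multiples of `t`, of either sign, are split off; the rest lies in `C (T.erase t)`.
        have hdec : ∀ y ∈ PointedCone.hull ℝ (latticeVec ''
            (((T.erase t ∪ {t, -t}) ∪ (S₀ ∪ S₀.image fun s => -s) : Finset N) : Set N)),
            ∃ r : ℝ, y + r • latticeVec t ∈ C (T.erase t) := by
          intro y hy
          induction hy using Submodule.span_induction with
          | mem y hy =>
            obtain ⟨a, ha, rfl⟩ := hy
            rw [Finset.mem_coe, Finset.mem_union, Finset.mem_union, Finset.mem_union,
              Finset.mem_image, Finset.mem_insert, Finset.mem_singleton] at ha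
            rcases ha with (ha | rfl | rfl) | ha | ⟨s, hs, rfl⟩
            · exact ⟨0, by rw [zero_smul, add_zero]; exact hTC _ _ ha⟩
            · exact ⟨-1, by rw [neg_one_smul, add_neg_cancel]; exact Submodule.zero_mem _⟩
            · exact ⟨1, by
                rw [one_smul, latticeVec_neg, neg_add_cancel]; exact Submodule.zero_mem _⟩
            · exact ⟨0, by
                rw [zero_smul, add_zero]
                exact hKC _ _ (Submodule.subset_span (hS₀σ _ ha))⟩
            · exact ⟨0, by
                rw [zero_smul, add_zero, latticeVec_neg]
                exact hKC _ _ (K.neg_mem (Submodule.subset_span (hS₀σ _ hs)))⟩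
          | zero => exact ⟨0, by simp⟩
          | add y z _ _ hy hz =>
            obtain ⟨r, hr⟩ := hy
            obtain ⟨r', hr'⟩ := hz
            refine ⟨r + r', ?_⟩
            have := Submodule.add_mem _ hr hr'
            rwa [add_add_add_comm, ← add_smul] at this
          | smul a y _ hy =>
            obtain ⟨r, hr⟩ := hy
            refine ⟨(a : ℝ) * r, ?_⟩
            have := PointedCone.smul_mem _ a.2 hr
            rw [smul_add, smul_smul] at this
            exact this
        obtain ⟨r, hr⟩ := hdec _ hcon
        rw [latticeVec_neg] at hr
        have hr2 : r • latticeVec t ∈ C (T.erase t) := by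
          have := Submodule.add_mem _ hr (hTC _ _ ht')
          rwa [add_comm, add_neg_cancel_left] at this
        have hr3 := huC _ ((Finset.erase_subset _ _).trans hTS) _ hr
        have hr4 := hupos t ht
        have hr5 := hupos t' (Finset.mem_of_mem_erase ht')
        -- Evaluating `u` at `-t' + r t` gives `r * u t ≥ u t' > 0`, so `r > 0`. Then `r t`, and
        -- with it `t`, lies in `C (T.erase t)`, against minimality.
        rw [map_add, map_neg, map_smul, smul_eq_mul] at hr3
        have hr6 : 0 < r := by
          by_contra! hneg
          nlinarith [mul_nonneg (neg_nonneg.2 hneg) hr4.le]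
        have := PointedCone.smul_mem _ (inv_nonneg.2 hr6.le) hr2
        rw [smul_smul, inv_mul_cancel₀ hr6.ne', one_smul] at this
        exact hmin t ht this
    choose w hwσ hwt hwT hwpos using key
    let w' : DualLattice N := ∑ t' ∈ T.erase t, w t'
    have hw'σ : ∀ y ∈ σ, pair w' y = 0 := fun y hy => by
      rw [pair_sum]; exact Finset.sum_eq_zero fun t' _ => hwσ t' y hy
    have hw't : pair w' (latticeVec t) = 0 := by
      rw [pair_sum]
      refine Finset.sum_eq_zero fun t' _ => ?_
      rw [pair_latticeVec, hwt, Int.cast_zero]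
    have hw'T : ∀ r ∈ T.erase t, 0 < pair w' (latticeVec r) := by
      intro r hr
      rw [pair_sum]
      refine Finset.sum_pos' (fun t' _ => ?_) ⟨r, hr, ?_⟩
      · rw [pair_latticeVec]; exact_mod_cast hwT t' r hr
      · rw [pair_latticeVec]; exact_mod_cast hwpos r hr
    -- Since `w'` is positive on all generators other than `t`, its zeros in `C T` involve only `K`
    -- and `t`. Thus the face `ρ` cut out by `w'` spans exactly `K` and `t`.
    have hC : ∀ y ∈ C T, 0 ≤ pair w' y ∧
        (pair w' y = 0 → y ∈ K ⊔ Submodule.span ℝ {latticeVec t}) := by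
      intro y hy
      induction hy using Submodule.span_induction with
      | mem y hy =>
        rcases hy with ⟨r, hr, rfl⟩ | hy
        · by_cases hrt : r = t
          · subst hrt
            exact ⟨hw't.ge, fun _ => Submodule.mem_sup_right (Submodule.mem_span_singleton_self _)⟩
          · have := hw'T r (Finset.mem_erase.2 ⟨hrt, hr⟩)
            exact ⟨this.le, fun h => absurd h this.ne'⟩
        · exact ⟨(hK0 _ hw'σ y hy).ge, fun _ => Submodule.mem_sup_left hy⟩
      | zero => exact ⟨by simp, fun _ => Submodule.zero_mem _⟩
      | add x y _ _ hx hy =>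
        rw [map_add]
        exact ⟨add_nonneg hx.1 hy.1, fun h0 => Submodule.add_mem _
          (hx.2 (by linarith [hx.1, hy.1])) (hy.2 (by linarith [hx.1, hy.1]))⟩
      | smul a x _ hx =>
        have : pair w' (a • x) = (a : ℝ) * pair w' x := by
          rw [← smul_eq_mul, ← map_smul]; rfl
        rw [this]
        refine ⟨mul_nonneg a.2 hx.1, fun h0 => ?_⟩
        rcases mul_eq_zero.1 h0 with h | h
        · rw [show a = 0 from Subtype.ext h, zero_smul]; exact Submodule.zero_mem _
        · exact Submodule.smul_mem _ (a : ℝ) (hx.2 h)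
    let ρ : PointedCone ℝ (RealSpace N) :=
      τ ⊓ (LinearMap.ker (pair w')).restrictScalars _
    have hρmem : ∀ y, y ∈ ρ ↔ y ∈ τ ∧ pair w' y = 0 := fun y => Iff.rfl
    have hρface : IsFace ρ τ := ⟨w', fun y hy => (hC y (hTτ hy)).1, hρmem⟩
    have hσρ : σ ≤ ρ := fun y hy => (hρmem y).2 ⟨((huσ y).1 hy).1, hw'σ y hy⟩
    have htρ : latticeVec t ∈ ρ := (hρmem _).2 ⟨hSτ _ (hTS ht), hw't⟩
    have hspan : Submodule.span ℝ (ρ : Set (RealSpace N)) =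
        K ⊔ Submodule.span ℝ {latticeVec t} := by
      refine le_antisymm (Submodule.span_le.2 fun y hy => ?_) (sup_le (Submodule.span_mono hσρ) ?_)
      · exact (hC y (hTτ ((hρmem y).1 hy).1)).2 ((hρmem y).1 hy).2
      · rw [Submodule.span_singleton_le_iff_mem]
        exact Submodule.subset_span htρ
    refine h ρ hρface hσρ ?_ _ htρ
    -- The form `u` vanishes on `K` but not at `t`, so adding `t` to `K` raises the dimension by
    -- exactly one.
    have hdisj : latticeVec t ∉ K := fun hcon =>
      (hupos t ht).ne' (hK0 (pair u) (fun y hy => ((huσ y).1 hy).2) _ hcon)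
    rw [coneDim, hspan]
    have ht0 : (latticeVec t : RealSpace N) ≠ 0 := fun h => hdisj (h ▸ K.zero_mem)
    have := Submodule.finrank_sup_add_finrank_inf_eq K (Submodule.span ℝ {latticeVec t})
    rwa [((Submodule.disjoint_span_singleton' ht0).2 hdisj).eq_bot, finrank_bot, add_zero,
      finrank_span_singleton ht0] at this
  refine nonneg_of_mem_hull l ?_ (hTτ hx)
  rintro _ (⟨t, ht, rfl⟩ | hy)
  · exact hlT t ht
  · exact (hK0 l h0 _ hy).ge

/-- A linear form that is nonnegative on the rays of a cone is nonnegative on the cone. -/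
theorem Fan.nonneg_of_nonneg_on_rays (Δ : Fan N) (τ : Δ.Cone) (l : RealSpace N →ₗ[ℝ] ℝ)
    (h : ∀ i : Δ.Ray, i.1 ≤ τ → 0 ≤ l (latticeVec (Δ.rayVec i))) {x : RealSpace N} (hx : x ∈ τ.1) :
    0 ≤ l x := by
  -- This is the preceding result for the zero face, whose next faces are the rays.
  have hbot := isFace_bot (Δ.rational _ τ.2) (Δ.stronglyConvex _ τ.2)
  have hdim : coneDim (⊥ : PointedCone ℝ (RealSpace N)) = 0 := by
    rw [coneDim, Submodule.bot_coe, Submodule.span_zero_singleton, finrank_bot]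
  refine nonneg_of_nonneg_on_next_faces (Δ.rational _ τ.2)
    (Δ.rational _ (Δ.face_mem _ τ.2 _ hbot)) hbot l
    (fun y hy => by rw [(Submodule.mem_bot _).1 hy, map_zero]) (fun ρ hρ _ hd y hy => ?_) hx
  rw [hdim, zero_add] at hd
  let i : Δ.Ray := ⟨⟨ρ, Δ.face_mem _ τ.2 _ hρ⟩, hd⟩
  obtain ⟨r, hr, rfl⟩ := Δ.exists_eq_smul_rayVec i hy
  rw [map_smul, smul_eq_mul]
  exact mul_nonneg hr (h i hρ.le)

theorem Fan.eq_zero_of_eq_zero_on_rays (Δ : Fan N) (τ : Δ.Cone) (l : RealSpace N →ₗ[ℝ] ℝ)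
    (h : ∀ i : Δ.Ray, i.1 ≤ τ → l (latticeVec (Δ.rayVec i)) = 0) {x : RealSpace N}
    (hx : x ∈ τ.1) : l x = 0 := by
  have h1 := Δ.nonneg_of_nonneg_on_rays τ l (fun i hi => (h i hi).ge) hx
  have h2 := Δ.nonneg_of_nonneg_on_rays τ (-l) (fun i hi => by simp [h i hi]) hx
  rw [LinearMap.neg_apply] at h2
  linarith

end ConeFaces

/-! ### Support functions, relations between rays, and the criterion by forms -/

section Divisors

variable {N : Type u} [AddCommGroup N] {Δ : Fan N}

theorem Fan.self_mem_starOne (σ : Δ.Cone) : σ ∈ Δ.starOne σ :=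
  ⟨σ, le_rfl, .inl rfl, le_rfl⟩

theorem Fan.starOne_of_le {σ ρ π : Δ.Cone} (h : π ≤ ρ) (hρ : ρ ∈ Δ.starOne σ) :
    π ∈ Δ.starOne σ := by
  obtain ⟨τ, h1, h2, h3⟩ := hρ
  exact ⟨τ, h1, h2, h.trans h3⟩

variable [Module.Free ℤ N]

/-- A real combination of divisors of characters is given by one real linear form, the same
combination of the forms `pair u`. -/
theorem LinearlyEquivalent.exists_linearForm {a a' : Δ.Ray → ℝ} (h : LinearlyEquivalent Δ a a') :
    ∃ l : RealSpace N →ₗ[ℝ] ℝ, ∀ i, a' i = a i + l (latticeVec (Δ.rayVec i)) := by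
  have key : ∀ c ∈ Submodule.span ℝ (Set.range (divCharacter Δ)),
      ∃ l : RealSpace N →ₗ[ℝ] ℝ, ∀ i, c i = l (latticeVec (Δ.rayVec i)) := by
    intro c hc
    induction hc using Submodule.span_induction with
    | mem c hc =>
      obtain ⟨u, rfl⟩ := hc
      exact ⟨pair u, fun i => by rw [pair_latticeVec, divCharacter]⟩
    | zero => exact ⟨0, fun _ => rfl⟩
    | add c d _ _ hc hd =>
      obtain ⟨l, hl⟩ := hc
      obtain ⟨l', hl'⟩ := hd
      exact ⟨l + l', fun i => by rw [Pi.add_apply, hl, hl', LinearMap.add_apply]⟩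
    | smul r c _ hc =>
      obtain ⟨l, hl⟩ := hc
      exact ⟨r • l, fun i => by rw [Pi.smul_apply, hl, LinearMap.smul_apply]⟩
  obtain ⟨l, hl⟩ := key _ h
  exact ⟨l, fun i => by rw [← hl, Pi.sub_apply, add_sub_cancel]⟩

/-- The relation is split as `∑ b⁺ v = ∑ b⁻ v`. Since `b⁻` is supported on the rays of `σ`, the
common value lies in `σ`, where `D.psi` is linear and takes the value `∑ a b⁻`; convexity bounds
this by `∑ a b⁺`. -/
theorem CartierDivisor.sum_coeff_mul_nonneg (D : CartierDivisor Δ) (σ : Δ.Cone)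
    (h : ConvexOnStarOne σ D.psi) (b : Δ.Ray → ℝ)
    (hb : ∑ i, b i • latticeVec (Δ.rayVec i) = 0)
    (hb0 : ∀ i : Δ.Ray, i.1 ∉ Δ.starOne σ → b i = 0)
    (hb1 : ∀ i : Δ.Ray, i.1 ∈ Δ.starOne σ → ¬ i.1 ≤ σ → 0 ≤ b i) :
    0 ≤ ∑ i, (D.coeff i : ℝ) * b i := by
  have hpm : ∀ i, b i = max (b i) 0 - max (-b i) 0 := fun i => by
    rcases le_total (b i) 0 with h | h
    · rw [max_eq_right h, max_eq_left (by linarith)]; ring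
    · rw [max_eq_left h, max_eq_right (by linarith)]; ring
  have hneg : ∀ i : Δ.Ray, ¬ i.1 ≤ σ → max (-b i) 0 = 0 := fun i hi => by
    refine max_eq_right ?_
    by_cases hs : i.1 ∈ Δ.starOne σ
    · linarith [hb1 i hs hi]
    · rw [hb0 i hs, neg_zero]
  have hsum : ∑ i, max (b i) 0 • (latticeVec (Δ.rayVec i) : RealSpace N) =
      ∑ i, max (-b i) 0 • (latticeVec (Δ.rayVec i) : RealSpace N) := by
    refine _root_.sub_eq_zero.1 ?_
    rw [← Finset.sum_sub_distrib, ← hb]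
    refine Finset.sum_congr rfl fun i _ => ?_
    rw [← sub_smul, ← hpm]
  have hmem : ∑ i, max (-b i) 0 • (latticeVec (Δ.rayVec i) : RealSpace N) ∈ σ.1 := by
    refine Submodule.sum_mem _ fun i _ => ?_
    by_cases hi : i.1 ≤ σ
    · exact PointedCone.smul_mem _ (le_max_right _ _) (hi (Δ.rayVec_mem i))
    · rw [hneg i hi, zero_smul]; exact Submodule.zero_mem _
  have hpsi : ∀ (i : Δ.Ray) (r : ℝ), 0 ≤ r →
      D.psi (r • latticeVec (Δ.rayVec i)) = r * D.coeff i := by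
    intro i r hr
    rw [D.psi_eq (PointedCone.smul_mem _ hr (Δ.rayVec_mem i)), map_smul, smul_eq_mul,
      pair_latticeVec, D.localForm_rayVec le_rfl]
    push_cast
    ring
  have e := Fintype.equivFin Δ.Ray
  have hre : ∀ {V : Type u} [AddCommMonoid V] (f : Δ.Ray → V),
      ∑ j, f (e.symm j) = ∑ i, f i := fun f => e.symm.sum_comp f
  have key := h _ (fun j => max (b (e.symm j)) 0 • latticeVec (Δ.rayVec (e.symm j)))
    (fun j => by
      by_cases hs : (e.symm j).1 ∈ Δ.starOne σ
      · exact ⟨_, hs, PointedCone.smul_mem _ (le_max_right _ _) (Δ.rayVec_mem _)⟩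
      -- Rays outside `star¹(σ)` contribute the point `0`, which lies in `σ`.
      · refine ⟨σ, Fan.self_mem_starOne σ, ?_⟩
        rw [hb0 _ hs, max_self, zero_smul]
        exact Submodule.zero_mem _)
    (by rw [hre fun i => max (b i) 0 • latticeVec (Δ.rayVec i), hsum]; exact hmem)
  rw [hre fun i => max (b i) 0 • latticeVec (Δ.rayVec i), hsum, D.psi_eq hmem, map_sum,
    e.symm.sum_comp fun i => D.psi (max (b i) 0 • latticeVec (Δ.rayVec i))] at key
  have h1 : -∑ i, pair (D.localForm σ) (max (-b i) 0 • latticeVec (Δ.rayVec i)) =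
      ∑ i, max (-b i) 0 * (D.coeff i : ℝ) := by
    rw [← Finset.sum_neg_distrib]
    refine Finset.sum_congr rfl fun i _ => ?_
    by_cases hi : i.1 ≤ σ
    · rw [map_smul, smul_eq_mul, pair_latticeVec, D.localForm_rayVec hi]
      push_cast
      ring
    · rw [hneg i hi, zero_smul, map_zero, zero_mul, neg_zero]
  rw [h1, Finset.sum_congr rfl fun i _ => hpsi i _ (le_max_right _ _), ← sub_nonneg,
    ← Finset.sum_sub_distrib] at key
  refine key.trans_eq (Finset.sum_congr rfl fun i _ => ?_)
  rw [← sub_mul, ← hpm, mul_comm]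

variable [Module.Finite ℤ N]

/-- A divisor with an equivalent divisor that is trivial along `σ` and effective along `star¹(σ)`
has a support function that is convex on `star¹(σ)`. -/
theorem CartierDivisor.convexOnStarOne (D : CartierDivisor Δ) (σ : Δ.Cone) {a' : Δ.Ray → ℝ}
    (heq : LinearlyEquivalent Δ (fun i => (D.coeff i : ℝ)) a')
    (hσ : ∀ i : Δ.Ray, i.1 ≤ σ → a' i = 0)
    (hstar : ∀ i : Δ.Ray, i.1 ∈ Δ.starOne σ → 0 ≤ a' i) : ConvexOnStarOne σ D.psi := by
  obtain ⟨l, hl⟩ := heq.exists_linearForm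
  -- The signs of `a'` on the rays thus become signs of `l - u(τ)` on cones, and yield `-l ≤ ψ_D` on
  -- `star¹(σ)` with equality on `σ`.
  have hray : ∀ (τ : Δ.Cone) (i : Δ.Ray), i.1 ≤ τ →
      (l - pair (D.localForm τ)) (latticeVec (Δ.rayVec i)) = a' i := by
    intro τ i hi
    rw [LinearMap.sub_apply, pair_latticeVec, D.localForm_rayVec hi, hl]
    push_cast
    ring
  intro n x hx hsum
  have h1 : ∀ j, -l (x j) ≤ D.psi (x j) := by
    intro j
    obtain ⟨ρ, hρ, hxρ⟩ := hx j
    have := Δ.nonneg_of_nonneg_on_rays ρ (l - pair (D.localForm ρ)) (fun i hi => by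
      rw [hray ρ i hi]; exact hstar i (Fan.starOne_of_le hi hρ)) hxρ
    rw [LinearMap.sub_apply] at this
    rw [D.psi_eq hxρ]
    linarith
  have h2 : D.psi (∑ j, x j) = -l (∑ j, x j) := by
    have := Δ.eq_zero_of_eq_zero_on_rays σ (l - pair (D.localForm σ)) (fun i hi => by
      rw [hray σ i hi, hσ i hi]) hsum
    rw [LinearMap.sub_apply] at this
    rw [D.psi_eq hsum]
    linarith
  rw [h2, map_sum, ← Finset.sum_neg_distrib]
  exact Finset.sum_le_sum fun j _ => h1 j

/-- If `D` is nonnegative on the relations between the rays of `star¹(σ)` that are nonnegative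
outside `σ`, then there are `m > 0` and a lattice form `w` such that `w - m u(τ)` vanishes on `σ` and
is nonnegative on `τ` for all `τ ⊇ σ`. -/
theorem CartierDivisor.exists_form (D : CartierDivisor Δ) (σ : Δ.Cone)
    (h : ∀ b : Δ.Ray → ℝ, ∑ i, b i • latticeVec (Δ.rayVec i) = 0 →
      (∀ i : Δ.Ray, i.1 ∉ Δ.starOne σ → b i = 0) →
      (∀ i : Δ.Ray, i.1 ∈ Δ.starOne σ → ¬ i.1 ≤ σ → 0 ≤ b i) →
      0 ≤ ∑ i, (D.coeff i : ℝ) * b i) :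
    ∃ (m : ℕ) (w : DualLattice N), 0 < m ∧ ∀ τ : Δ.Cone, σ ≤ τ →
      (∀ x ∈ σ.1, pair (w - m • D.localForm τ) x = 0) ∧
      ∀ x ∈ τ.1, 0 ≤ pair (w - m • D.localForm τ) x := by
  classical
  obtain ⟨m, w, hm, hwσ, hw⟩ : ∃ (m : ℕ) (w : DualLattice N), 0 < m ∧
      (∀ i : Δ.Ray, i.1 ≤ σ → w (Δ.rayVec i) + m * D.coeff i = 0) ∧
      ∀ i : Δ.Ray, i.1 ∈ Δ.starOne σ → 0 ≤ w (Δ.rayVec i) + m * D.coeff i := by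
    -- A form on `N × ℤ` encodes `w` and `m` at once, `m` being its value at `(0, 1)`; the target
    -- `(0, -1)` makes `m` positive. Each ray of `σ` enters with both signs, so that `w + m a`
    -- vanishes there.
    let g : Δ.Ray → N × ℤ := fun i => (Δ.rayVec i, D.coeff i)
    let v : Δ.Ray ⊕ Δ.Ray → N × ℤ := Sum.elim g fun i => -g i
    let s : Finset (Δ.Ray ⊕ Δ.Ray) := Finset.disjSum
      (Finset.univ.filter fun i => i.1 ∈ Δ.starOne σ) (Finset.univ.filter fun i => i.1 ≤ σ)
    rcases exists_form_neg_or_nonneg_sum s v (0, -1) with ⟨f, hf, hft⟩ | ⟨c, hc, hct⟩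
    · have hf1 : ∀ x : N, ∀ a : ℤ, f (x, a) = f (x, 0) + f (0, 1) * a := by
        intro x a
        have : ((x, a) : N × ℤ) = (x, 0) + a • (0, 1) := by simp
        rw [this, map_add, map_smul, smul_eq_mul, mul_comm]
      have hpos : 0 < f (0, 1) := by
        have := hf1 0 (-1)
        rw [show ((0, 0) : N × ℤ) = 0 from rfl, map_zero] at this
        omega
      have hstar : ∀ i : Δ.Ray, i.1 ∈ Δ.starOne σ →
          0 ≤ f (Δ.rayVec i, 0) + f (0, 1) * D.coeff i := by
        intro i hi
        have := hf (.inl i) (by simpa [s] using hi)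
        change 0 ≤ f (Δ.rayVec i, D.coeff i) at this
        rwa [hf1] at this
      refine ⟨(f (0, 1)).toNat, f ∘ₗ LinearMap.inl ℤ N ℤ, by omega, fun i hi => ?_, fun i hi => ?_⟩
      · have h1 := hstar i (Fan.starOne_of_le hi (Fan.self_mem_starOne σ))
        have h2 := hf (.inr i) (by simpa [s] using hi)
        change 0 ≤ f (-g i) at h2
        rw [map_neg] at h2
        change 0 ≤ -f (Δ.rayVec i, D.coeff i) at h2
        rw [hf1] at h2
        rw [Int.toNat_of_nonneg hpos.le]
        change f (Δ.rayVec i, 0) + _ = 0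
        omega
      · rw [Int.toNat_of_nonneg hpos.le]
        exact hstar i hi
    · exfalso
      -- In the other alternative of Farkas' lemma these coefficients form a relation between the
      -- `v_i`, admissible in `h`, with `∑ a_i b_i = -1`.
      let b : Δ.Ray → ℝ := fun i => (if i.1 ∈ Δ.starOne σ then c (.inl i) else 0) -
        (if i.1 ≤ σ then c (.inr i) else 0)
      have hsum : ∀ f : N × ℤ →ₗ[ℤ] ℤ, (f (0, -1) : ℝ) = ∑ i, b i * f (g i) := by
        intro f
        rw [hct f, Finset.sum_disjSum, Finset.sum_filter, Finset.sum_filter,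
          ← Finset.sum_add_distrib]
        refine Finset.sum_congr rfl fun i _ => ?_
        simp only [b, v, Sum.elim_inl, Sum.elim_inr, map_neg, Int.cast_neg]
        split_ifs <;> ring
      have h1 := h b (eq_of_forall_pair_eq fun u => by
          have := hsum (u ∘ₗ LinearMap.fst ℤ N ℤ)
          rw [map_sum, map_zero]
          simp only [LinearMap.comp_apply, LinearMap.fst_apply, map_zero, Int.cast_zero] at this
          rw [this]
          refine Finset.sum_congr rfl fun i _ => ?_
          rw [map_smul, pair_latticeVec, smul_eq_mul])
        (fun i hi => by
          have : ¬ i.1 ≤ σ := fun h => hi (Fan.starOne_of_le h (Fan.self_mem_starOne σ))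
          simp [b, hi, this])
        (fun i hi hiσ => by
          simp only [b, hi, hiσ, if_true, if_false, sub_zero]
          exact hc _)
      have h2 := hsum (LinearMap.snd ℤ N ℤ)
      have h3 : ∑ i, (D.coeff i : ℝ) * b i = ∑ i, b i * (LinearMap.snd ℤ N ℤ (g i) : ℝ) :=
        Finset.sum_congr rfl fun i _ => mul_comm _ _
      rw [h3, ← h2] at h1
      simp at h1
      linarith
  refine ⟨m, w, hm, fun τ hστ => ?_⟩
  have hray : ∀ (τ : Δ.Cone) (i : Δ.Ray), i.1 ≤ τ →
      pair (w - m • D.localForm τ) (latticeVec (Δ.rayVec i)) =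
        ((w (Δ.rayVec i) + m * D.coeff i : ℤ) : ℝ) := by
    intro τ i hi
    rw [pair_latticeVec, LinearMap.sub_apply, LinearMap.smul_apply, D.localForm_rayVec hi]
    congr 1
    rw [nsmul_eq_mul]
    ring
  have hzero : ∀ x ∈ σ.1, pair (w - m • D.localForm τ) x = 0 := fun x hx =>
    Δ.eq_zero_of_eq_zero_on_rays σ _ (fun i hi => by
      rw [hray τ i (hi.trans hστ), hwσ i hi, Int.cast_zero]) hx
  refine ⟨hzero, fun x hx => ?_⟩
  -- The cone `τ` itself need not belong to `star¹(σ)`, but its faces of dimension `dim σ + 1`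
  -- containing `σ` do.
  refine nonneg_of_nonneg_on_next_faces (Δ.rational _ τ.2) (Δ.rational _ σ.2)
    (Fan.isFace_of_le hστ) _ hzero (fun ρ hρ hσρ hd y hy => ?_) hx
  let ρ' : Δ.Cone := ⟨ρ, Δ.face_mem _ τ.2 _ hρ⟩
  have hρτ : ρ' ≤ τ := hρ.le
  refine Δ.nonneg_of_nonneg_on_rays ρ' _ (fun i hi => ?_) hy
  rw [hray τ i (hi.trans hρτ)]
  exact Int.cast_nonneg (hw i ⟨ρ', hσρ, .inr hd, hi⟩)

end Divisors

/-! ### The coordinate ring of an orbit inside `k[M]` -/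

section OrbitRing

variable {N : Type u} [AddCommGroup N]

/-- This makes `k[M]` a domain, so that the kernel of `orbitRingHom` is prime. -/
instance : UniqueSums (DualLattice N) :=
  UniqueSums.of_injective_addHom
    ({ toFun := fun u x => u x, map_add' := fun _ _ => rfl } : AddHom (DualLattice N) (N → ℤ))
    DFunLike.coe_injective inferInstance


/-- The property of lattice forms to vanish on `σ`. -/
def VanishesOn (σ : PointedCone ℝ (RealSpace N)) (u : DualLattice N) : Prop :=
  ∀ x ∈ σ, pair u x = 0

variable (k : Type u) [Field k]

open Classical in
/-- The map on characters underlying `orbitRingHom`. -/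
def orbitMonoidHom (σ : PointedCone ℝ (RealSpace N)) :
    Multiplicative (dualMonoid σ) →* AddMonoidAlgebra k (DualLattice N) where
  toFun := fun u => if VanishesOn σ (u.toAdd : DualLattice N) then
    AddMonoidAlgebra.single (u.toAdd : DualLattice N) 1 else 0
  map_one' := by
    have h0 : VanishesOn σ ((Multiplicative.toAdd (1 : Multiplicative (dualMonoid σ)) :
        dualMonoid σ) : DualLattice N) := fun x _ => pair_zero x
    rw [if_pos h0]
    rfl
  map_mul' := fun u w => by
    -- Both forms are nonnegative on `σ`, so their sum vanishes at a point only if both do. This is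
    -- what makes the map multiplicative.
    have hiff : VanishesOn σ ((u * w).toAdd : DualLattice N) ↔
        VanishesOn σ (u.toAdd : DualLattice N) ∧ VanishesOn σ (w.toAdd : DualLattice N) := by
      have hadd : ((u * w).toAdd : DualLattice N) = (u.toAdd : DualLattice N) + w.toAdd := rfl
      rw [hadd]
      refine ⟨fun h => ⟨fun x hx => ?_, fun x hx => ?_⟩, fun h x hx => ?_⟩
      · have h1 := h x hx
        rw [pair_add] at h1
        linarith [u.toAdd.2 x hx, w.toAdd.2 x hx]
      · have h1 := h x hx
        rw [pair_add] at h1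
        linarith [u.toAdd.2 x hx, w.toAdd.2 x hx]
      · rw [pair_add, h.1 x hx, h.2 x hx, add_zero]
    by_cases hu : VanishesOn σ (u.toAdd : DualLattice N)
    · by_cases hw : VanishesOn σ (w.toAdd : DualLattice N)
      · rw [if_pos (hiff.2 ⟨hu, hw⟩), if_pos hu, if_pos hw,
          AddMonoidAlgebra.single_mul_single, mul_one]
        rfl
      · rw [if_neg fun h => hw (hiff.1 h).2, if_neg hw, mul_zero]
    · rw [if_neg fun h => hu (hiff.1 h).1, if_neg hu, zero_mul]

/-- The ring homomorphism `k[σ^∨ ∩ M] → k[M]` that sends `χ^u` to itself if `u` vanishes on `σ`, and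
to `0` otherwise. Its image is the coordinate ring of the orbit of `σ`. -/
def orbitRingHom (σ : PointedCone ℝ (RealSpace N)) :
    CoordRing k σ →+* AddMonoidAlgebra k (DualLattice N) :=
  (AddMonoidAlgebra.lift k (AddMonoidAlgebra k (DualLattice N)) (dualMonoid σ)
    (orbitMonoidHom k σ)).toRingHom

variable {σ : PointedCone ℝ (RealSpace N)}

theorem orbitRingHom_single_of_vanishesOn {u : dualMonoid σ}
    (hu : VanishesOn σ (u : DualLattice N)) (r : k) :
    orbitRingHom k σ (AddMonoidAlgebra.single u r) =
      AddMonoidAlgebra.single (u : DualLattice N) r := by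
  refine (AddMonoidAlgebra.lift_single _ _ _).trans ?_
  rw [orbitMonoidHom, MonoidHom.coe_mk, OneHom.coe_mk, toAdd_ofAdd, if_pos hu, AddMonoidAlgebra.smul_single, smul_eq_mul, mul_one]

theorem orbitRingHom_single_of_not_vanishesOn {u : dualMonoid σ}
    (hu : ¬ VanishesOn σ (u : DualLattice N)) (r : k) :
    orbitRingHom k σ (AddMonoidAlgebra.single u r) = 0 := by
  refine (AddMonoidAlgebra.lift_single _ _ _).trans ?_
  rw [orbitMonoidHom, MonoidHom.coe_mk, OneHom.coe_mk, toAdd_ofAdd, if_neg hu, smul_zero]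

theorem coeff_orbitRingHom (f : CoordRing k σ) (u : dualMonoid σ)
    (hu : VanishesOn σ (u : DualLattice N)) :
    (orbitRingHom k σ f).coeff (u : DualLattice N) = f.coeff u := by
  classical
  induction f using AddMonoidAlgebra.induction_linear with
  | zero => simp
  | add f g hf hg => rw [map_add, AddMonoidAlgebra.coeff_add, Finsupp.add_apply, hf, hg]; rfl
  | single w r =>
    by_cases hw : VanishesOn σ (w : DualLattice N)
    · rw [orbitRingHom_single_of_vanishesOn k hw, AddMonoidAlgebra.coeff_single,
        AddMonoidAlgebra.coeff_single, Finsupp.single_apply, Finsupp.single_apply]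
      simp only [Subtype.ext_iff]
    · rw [orbitRingHom_single_of_not_vanishesOn k hw, AddMonoidAlgebra.coeff_single,
        Finsupp.single_apply, if_neg]
      · rfl
      · rintro rfl
        exact hw hu

/-- The exponents of the image of a function on `U_τ` in the coordinate ring of the orbit of
`σ ≤ τ` vanish on `σ` and are nonnegative on `τ`. -/
theorem mem_of_coeff_orbitRingHom_ne_zero {τ : PointedCone ℝ (RealSpace N)} (h : σ ≤ τ)
    (f : CoordRing k τ) (w : DualLattice N)
    (hw : (orbitRingHom k σ (coordMap k h f)).coeff w ≠ 0) :
    VanishesOn σ w ∧ w ∈ dualMonoid τ := by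
  classical
  induction f using AddMonoidAlgebra.induction_linear with
  | zero => simp at hw
  | add f g hf hg =>
    rw [map_add, map_add, AddMonoidAlgebra.coeff_add, Finsupp.add_apply] at hw
    by_cases h1 : (orbitRingHom k σ (coordMap k h f)).coeff w = 0
    · refine hg fun h2 => hw ?_
      rw [h1, h2, add_zero]
    · exact hf h1
  | single u r =>
    rw [coordMap_single] at hw
    have hcoe : ((AddSubmonoid.inclusion (dualMonoid_anti h) u : dualMonoid σ) : DualLattice N) = u :=
      rfl
    generalize AddSubmonoid.inclusion (dualMonoid_anti h) u = u' at hw hcoe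
    by_cases hu : VanishesOn σ (u' : DualLattice N)
    · rw [orbitRingHom_single_of_vanishesOn k hu, AddMonoidAlgebra.coeff_single,
        Finsupp.single_apply] at hw
      have hu'w : (u' : DualLattice N) = w := by
        by_contra hne
        exact hw (if_neg hne)
      rw [← hu'w]
      exact ⟨hu, hcoe ▸ u.2⟩
    · rw [orbitRingHom_single_of_not_vanishesOn k hu] at hw
      exact absurd rfl hw

/-- A function on `U_σ` vanishes at all points of the orbit of `σ` if and only if its image in the
coordinate ring of the orbit is zero. -/
theorem orbitRingHom_eq_zero_iff (f : CoordRing k σ) :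
    orbitRingHom k σ f = 0 ↔ ∀ p : PrimeSpectrum (CoordRing k σ),
      (∀ u : dualMonoid σ, (∃ x ∈ σ, pair (u : DualLattice N) x ≠ 0) →
        character k u ∈ p.asIdeal) → f ∈ p.asIdeal := by
  constructor
  · intro hf p hp
    rw [← AddMonoidAlgebra.sum_coeff_single f]
    refine Ideal.sum_mem _ fun u hu => ?_
    by_cases hv : VanishesOn σ (u : DualLattice N)
    · rw [← coeff_orbitRingHom k f u hv, hf]
      simp
    · have : AddMonoidAlgebra.single u (f.coeff u) =
          AddMonoidAlgebra.single 0 (f.coeff u) * character k u := by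
        rw [character, AddMonoidAlgebra.single_mul_single, zero_add, mul_one]
      rw [this]
      refine Ideal.mul_mem_left _ _ (hp u ?_)
      unfold VanishesOn at hv
      push Not at hv
      exact hv
  · intro h
    -- The kernel is itself a point of the orbit, in fact its generic point; testing `f` there
    -- suffices.
    have hprime : (RingHom.ker (orbitRingHom k σ)).IsPrime := RingHom.ker_isPrime _
    refine h ⟨_, hprime⟩ fun u hu => ?_
    obtain ⟨x, hx, hne⟩ := hu
    exact orbitRingHom_single_of_not_vanishesOn k (fun hv => hne (hv x hx)) 1

end OrbitRing

/-! ### Functions on the orbit closure in the affine charts -/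

section OrbitClosure

variable {N : Type u} [AddCommGroup N] (Δ : Fan N) (k : Type u) [Field k]

theorem Fan.isAffineOpen_chartOpen (τ : Δ.Cone) : IsAffineOpen (Δ.chartOpen k τ) :=
  isAffineOpen_opensRange (Δ.chart k τ)

theorem Fan.chartFun_surjective (τ : Δ.Cone) : Function.Surjective (Δ.chartFun k τ) := by
  have h1 : IsIso (homOfLE (Δ.chart k τ).image_top_eq_opensRange.ge) :=
    ⟨homOfLE (Δ.chart k τ).image_top_eq_opensRange.le, rfl, rfl⟩
  have h2 : IsIso ((Δ.toricVariety k).presheaf.map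
      (homOfLE (Δ.chart k τ).image_top_eq_opensRange.ge).op) := inferInstance
  have h3 : Function.Surjective
      ((Δ.chart k τ).appIso ⊤).inv.hom :=
    (ConcreteCategory.bijective_of_isIso ((Δ.chart k τ).appIso ⊤).inv).2
  have h4 : Function.Surjective (Scheme.ΓSpecIso (.of (CoordRing k τ.1))).inv.hom :=
    (ConcreteCategory.bijective_of_isIso (Scheme.ΓSpecIso (.of (CoordRing k τ.1))).inv).2
  rw [Fan.chartFun, RingHom.coe_comp, RingHom.coe_comp]
  exact ((@ConcreteCategory.bijective_of_isIso CommRingCat _ _ _ _ _ _ _ _ h2).2).comp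
    (h3.comp h4)

theorem Fan.chart_mem_basicOpen_iff {ρ τ : Δ.Cone} (h : ρ ≤ τ) (f : CoordRing k τ.1)
    (p : PrimeSpectrum (CoordRing k ρ.1)) :
    Δ.chart k ρ p ∈ (Δ.toricVariety k).basicOpen (Δ.chartFun k τ f) ↔
      coordMap k h f ∉ p.asIdeal := by
  have h1 : Δ.chart k ρ p ∈ (Δ.toricVariety k).basicOpen (Δ.chartFun k τ f) ↔
      Δ.chart k ρ p ∈ (Δ.toricVariety k).basicOpen (Δ.chartFun k ρ (coordMap k h f)) := by
    have := Scheme.basicOpen_res (Δ.toricVariety k) (Δ.chartFun k τ f)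
      (homOfLE (Δ.chartOpen_mono k h)).op
    rw [← Δ.res_chartFun k h]
    change _ ↔ Δ.chart k ρ p ∈ (Δ.toricVariety k).basicOpen
      ((Δ.toricVariety k).presheaf.map (homOfLE (Δ.chartOpen_mono k h)).op (Δ.chartFun k τ f))
    rw [this]
    exact ⟨fun hx => ⟨⟨p, rfl⟩, hx⟩, fun hx => hx.2⟩
  have h2 := Scheme.basicOpen_appLE (Δ.chart k ρ) ⊤ (Δ.chartOpen k ρ) (Δ.top_le_preimage k ρ)
    (Δ.chartFun k ρ (coordMap k h f))
  have h3 : (Spec (.of (CoordRing k ρ.1))).basicOpen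
      ((Δ.chart k ρ).appLE (Δ.chartOpen k ρ) ⊤ (Δ.top_le_preimage k ρ)
        (Δ.chartFun k ρ (coordMap k h f))) = PrimeSpectrum.basicOpen (coordMap k h f) :=
    (congrArg _ (Δ.appLE_chartFun k ρ (coordMap k h f))).trans (basicOpen_eq_of_affine _)
  rw [h3, top_inf_eq] at h2
  rw [h1]
  exact (SetLike.ext_iff.1 h2 p).symm

/-- A function vanishes on the closure exactly if its nonvanishing locus, being open, misses the
orbit. The orbit lies in `U_σ`, where `orbitRingHom` detects vanishing on it. -/
theorem Fan.mem_orbitClosureIdeal_iff {σ τ : Δ.Cone} (h : σ ≤ τ) (f : CoordRing k τ.1) :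
    Δ.chartFun k τ f ∈ (Δ.orbitClosureIdeal k σ).ideal ⟨_, Δ.isAffineOpen_chartOpen k τ⟩ ↔
      orbitRingHom k σ.1 (coordMap k h f) = 0 := by
  rw [orbitRingHom_eq_zero_iff]
  have h1 : Δ.chartFun k τ f ∈
      (Δ.orbitClosureIdeal k σ).ideal ⟨_, Δ.isAffineOpen_chartOpen k τ⟩ ↔
      Disjoint (closure (Δ.orbit k σ))
        ((Δ.toricVariety k).basicOpen (Δ.chartFun k τ f) : Set (Δ.toricVariety k)) := by
    rw [Fan.orbitClosureIdeal, Scheme.IdealSheafData.vanishingIdeal_ideal,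
      PrimeSpectrum.mem_vanishingIdeal]
    rw [← (Δ.isAffineOpen_chartOpen k τ).fromSpec_image_basicOpen, Set.disjoint_right]
    constructor
    · rintro hf _ ⟨p, hp, rfl⟩ hcl
      exact hp (hf p hcl)
    · intro hd p hp
      by_contra hcon
      exact hd ⟨p, hcon, rfl⟩ hp
  have h2 := ((Δ.toricVariety k).basicOpen (Δ.chartFun k τ f)).isOpen
  rw [h1, show Disjoint (closure (Δ.orbit k σ)) _ ↔ Disjoint (Δ.orbit k σ) _ from
    ⟨fun hd => hd.mono_left subset_closure, fun hd => hd.closure_left h2⟩, Set.disjoint_left]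
  constructor
  · intro hd p hp
    by_contra hcon
    exact hd ⟨p, hp, rfl⟩ ((Δ.chart_mem_basicOpen_iff k h f p).2 hcon)
  · rintro hf _ ⟨p, hp, rfl⟩ hmem
    exact (Δ.chart_mem_basicOpen_iff k h f p).1 hmem (hf p hp)

/-- If the open set `U_τ` meets the closure it meets the orbit, at a point of `U_{σ ∩ τ}`. There the
character cutting out the face `σ ∩ τ` of `σ` is invertible; but when this face is proper, that
character vanishes on the orbit. -/
theorem Fan.orbitClosure_preimage_eq_bot {σ τ : Δ.Cone} (h : ¬ σ ≤ τ) :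
    Δ.orbitClosureι k σ ⁻¹ᵁ Δ.chartOpen k τ = ⊥ := by
  refine le_bot_iff.1 fun x hx => ?_
  have hcl : Δ.orbitClosureι k σ x ∈ closure (Δ.orbit k σ) := by
    have h1 : Δ.orbitClosureι k σ x ∈ Set.range (Δ.orbitClosureι k σ) := ⟨x, rfl⟩
    have h2 : Set.range (Δ.orbitClosureι k σ) = closure (Δ.orbit k σ) :=
      (Δ.orbitClosureIdeal k σ).range_subschemeι.trans
        (Scheme.IdealSheafData.coe_support_vanishingIdeal _)
    rwa [h2] at h1
  obtain ⟨y, hy, p, hp, rfl⟩ := mem_closure_iff.1 hcl _ (Δ.chartOpen k τ).isOpen hx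
  obtain ⟨q, hq⟩ := Δ.inf_chartOpen_le k σ τ ⟨⟨p, rfl⟩, hy⟩
  let g : Δ.meet σ τ ⟶ σ := homOfLE (Δ.meet_le_left σ τ)
  obtain ⟨u, hu, hface⟩ := Fan.isFace_of_le (Δ.meet_le_left σ τ)
  have hpq : (Δ.diagram k).map g q = p := by
    apply (Δ.chart k σ).isOpenEmbedding.injective
    rw [← hq, ← Δ.map_chart k (Δ.meet_le_left σ τ)]
    exact (Scheme.Hom.comp_apply _ _ _).symm
  have hr : p ∈ Set.range ((Δ.diagram k).map g) := ⟨q, hpq⟩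
  rw [range_diagram_map Δ k g ⟨u, hu⟩ hface] at hr
  refine hr (hp ⟨u, hu⟩ ?_)
  by_contra! hcon
  refine h fun x hx => ?_
  exact (Submodule.mem_inf.1 ((hface x).2 ⟨hx, hcon x hx⟩)).2

/-- The restriction to `V(σ) ∩ U_τ` of a function on `U_τ`. -/
def Fan.orbitClosureFun (σ τ : Δ.Cone) :
    CoordRing k τ.1 →+* Γ(Δ.orbitClosure k σ, Δ.orbitClosureι k σ ⁻¹ᵁ Δ.chartOpen k τ) :=
  ((Δ.orbitClosureι k σ).app (Δ.chartOpen k τ)).hom.comp (Δ.chartFun k τ)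

theorem Fan.orbitClosureFun_surjective (σ τ : Δ.Cone) :
    Function.Surjective (Δ.orbitClosureFun k σ τ) := by
  rw [Fan.orbitClosureFun, RingHom.coe_comp]
  exact Function.Surjective.comp ((Δ.orbitClosureIdeal k σ).subschemeι_app_surjective
    ⟨_, Δ.isAffineOpen_chartOpen k τ⟩) (Δ.chartFun_surjective k τ)

theorem Fan.orbitClosureFun_eq_zero_iff {σ τ : Δ.Cone} (h : σ ≤ τ) (f : CoordRing k τ.1) :
    Δ.orbitClosureFun k σ τ f = 0 ↔ orbitRingHom k σ.1 (coordMap k h f) = 0 := by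
  rw [← Δ.mem_orbitClosureIdeal_iff k h, ← Scheme.IdealSheafData.ker_subschemeι_app,
    RingHom.mem_ker]
  rfl

theorem res_app {X Y : Scheme.{u}} (f : Y ⟶ X) {U V : X.Opens} (h : V ≤ U)
    (h' : f ⁻¹ᵁ V ≤ f ⁻¹ᵁ U) (s : Γ(X, U)) :
    res Y h' ((f.app U).hom s) = (f.app V).hom (res X h s) :=
  (ConcreteCategory.congr_hom (f.naturality (homOfLE h).op) s).symm

theorem Fan.res_orbitClosureFun (σ : Δ.Cone) {ρ τ : Δ.Cone} (h : ρ ≤ τ)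
    (h' : Δ.orbitClosureι k σ ⁻¹ᵁ Δ.chartOpen k ρ ≤ Δ.orbitClosureι k σ ⁻¹ᵁ Δ.chartOpen k τ)
    (f : CoordRing k τ.1) :
    res _ h' (Δ.orbitClosureFun k σ τ f) = Δ.orbitClosureFun k σ ρ (coordMap k h f) := by
  rw [Fan.orbitClosureFun, RingHom.comp_apply, res_app _ (Δ.chartOpen_mono k h), Δ.res_chartFun k h]
  rfl

end OrbitClosure

/-! ### Sections of the pulled back line bundle and characters -/

section Effective

variable {N : Type u} [AddCommGroup N] {Δ : Fan N} (k : Type u) [Field k]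

theorem character_pow {τ : PointedCone ℝ (RealSpace N)} (u : dualMonoid τ) (n : ℕ) :
    character k u ^ n = character k (n • u) := by
  induction n with
  | zero => simp [character_zero]
  | succ n ih => rw [pow_succ, ih, character_mul, succ_nsmul]

theorem orbitRingHom_coordMap_character {σ τ : PointedCone ℝ (RealSpace N)} (h : σ ≤ τ)
    (c : dualMonoid τ) (hc : VanishesOn σ (c : DualLattice N)) :
    orbitRingHom k σ (coordMap k h (character k c)) =
      AddMonoidAlgebra.single (c : DualLattice N) 1 := by
  rw [coordMap_character, character, orbitRingHom_single_of_vanishesOn]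
  · rfl
  · exact hc

theorem CartierDivisor.sub_mem_dualMonoid_meet (D : CartierDivisor Δ) (τ τ' : Δ.Cone) :
    D.localForm τ - D.localForm τ' ∈ dualMonoid (Δ.meet τ τ').1 := fun x hx =>
  (D.sub_eq_zero τ τ' _ (Δ.meet_le_left τ τ') (Δ.meet_le_right τ τ') x hx).ge

theorem Fan.preimage_chartOpen_mono (σ : Δ.Cone) {ρ τ : Δ.Cone} (h : ρ ≤ τ) :
    Δ.orbitClosureι k σ ⁻¹ᵁ Δ.chartOpen k ρ ≤ Δ.orbitClosureι k σ ⁻¹ᵁ Δ.chartOpen k τ :=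
  fun _ hx => Δ.chartOpen_mono k h hx

theorem subsingleton_of_eq_bot {X : Scheme.{u}} {U : X.Opens} (h : U = ⊥) :
    Subsingleton Γ(X, U) := by
  subst h
  infer_instance

theorem Fan.preimage_inf_chartOpen_le (σ τ τ' : Δ.Cone) :
    Δ.orbitClosureι k σ ⁻¹ᵁ Δ.chartOpen k τ ⊓ Δ.orbitClosureι k σ ⁻¹ᵁ Δ.chartOpen k τ' ≤
      Δ.orbitClosureι k σ ⁻¹ᵁ Δ.chartOpen k (Δ.meet τ τ') :=
  fun _ hx => Δ.inf_chartOpen_le k τ τ' hx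

theorem CartierDivisor.pullback_pow_trans (D : CartierDivisor Δ) (σ τ τ' : Δ.Cone) (m : ℕ) :
    ((((D.lineBundle k).pullback (Δ.orbitClosureι k σ)).pow m).trans τ τ').val =
      res _ (Δ.preimage_inf_chartOpen_le k σ τ τ') (Δ.orbitClosureFun k σ (Δ.meet τ τ')
        (character k ⟨_, D.sub_mem_dualMonoid_meet τ τ'⟩ ^ m)) := by
  rw [map_pow, map_pow]
  exact congrArg (· ^ m) (res_app (Δ.orbitClosureι k σ) (Δ.inf_chartOpen_le k τ τ') _ _).symm

theorem CartierDivisor.pullback_pow_isSection_iff (D : CartierDivisor Δ) (σ : Δ.Cone) (m : ℕ)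
    (s : ∀ τ : Δ.Cone, Γ(Δ.orbitClosure k σ, Δ.orbitClosureι k σ ⁻¹ᵁ Δ.chartOpen k τ)) :
    (((D.lineBundle k).pullback (Δ.orbitClosureι k σ)).pow m).IsSection s ↔
      ∀ τ τ' : Δ.Cone, res (Δ.orbitClosure k σ) (inf_le_right :
          Δ.orbitClosureι k σ ⁻¹ᵁ Δ.chartOpen k τ ⊓ Δ.orbitClosureι k σ ⁻¹ᵁ Δ.chartOpen k τ' ≤
            Δ.orbitClosureι k σ ⁻¹ᵁ Δ.chartOpen k τ') (s τ') =
        res _ (Δ.preimage_inf_chartOpen_le k σ τ τ') (Δ.orbitClosureFun k σ (Δ.meet τ τ')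
          (character k ⟨_, D.sub_mem_dualMonoid_meet τ τ'⟩ ^ m)) *
        res (Δ.orbitClosure k σ) (inf_le_left :
          Δ.orbitClosureι k σ ⁻¹ᵁ Δ.chartOpen k τ ⊓ Δ.orbitClosureι k σ ⁻¹ᵁ Δ.chartOpen k τ' ≤
            Δ.orbitClosureι k σ ⁻¹ᵁ Δ.chartOpen k τ) (s τ) := by
  refine forall_congr' fun τ => forall_congr' fun τ' => ?_
  rw [← D.pullback_pow_trans k σ τ τ' m]
  rfl

/-- Seen in `k[M]`, the local functions of a section differ from each other by the monomials
`χ^{m(u(τ₀) - u(τ))}`. One exponent `w₀` occurring on `U_{τ₀}` therefore occurs, suitably shifted,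
on every chart, and there its position in `σ^⊥` and `τ^∨` can be read off. -/
theorem CartierDivisor.exists_form_of_isEffective (D : CartierDivisor Δ) (σ : Δ.Cone)
    (h : ((D.lineBundle k).pullback (Δ.orbitClosureι k σ)).IsEffective) :
    ∃ (m : ℕ) (w : DualLattice N), 0 < m ∧ ∀ τ : Δ.Cone, σ ≤ τ →
      (∀ x ∈ σ.1, pair (w - m • D.localForm τ) x = 0) ∧
      ∀ x ∈ τ.1, 0 ≤ pair (w - m • D.localForm τ) x := by
  obtain ⟨m, hm, s, hs, hs0⟩ := h
  obtain ⟨τ₀, hτ₀⟩ : ∃ τ₀ : Δ.Cone, s τ₀ ≠ 0 := by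
    by_contra! hcon
    exact hs0 (funext hcon)
  have hστ₀ : σ ≤ τ₀ := by
    by_contra hcon
    exact hτ₀ ((subsingleton_of_eq_bot (Δ.orbitClosure_preimage_eq_bot k hcon)).elim _ _)
  choose f hf using fun τ => Δ.orbitClosureFun_surjective k σ τ (s τ)
  have hrel : ∀ (τ : Δ.Cone) (hτ : σ ≤ τ), orbitRingHom k σ.1 (coordMap k hτ (f τ)) =
      AddMonoidAlgebra.single (m • (D.localForm τ₀ - D.localForm τ)) 1 *
        orbitRingHom k σ.1 (coordMap k hστ₀ (f τ₀)) := by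
    intro τ hτ
    have hmeet : σ ≤ Δ.meet τ₀ τ := show σ.1 ≤ τ₀.1 ⊓ τ.1 from le_inf hστ₀ hτ
    -- All charts with `τ ⊇ σ` contain `U_σ`, so every gluing relation can be compared on this one
    -- open set.
    let W := Δ.orbitClosureι k σ ⁻¹ᵁ Δ.chartOpen k σ
    have hW : ∀ ρ : Δ.Cone, σ ≤ ρ → W ≤ Δ.orbitClosureι k σ ⁻¹ᵁ Δ.chartOpen k ρ :=
      fun ρ hρ => Δ.preimage_chartOpen_mono k σ hρ
    have h1 := congrArg (res _ (show W ≤ Δ.orbitClosureι k σ ⁻¹ᵁ Δ.chartOpen k τ₀ ⊓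
      Δ.orbitClosureι k σ ⁻¹ᵁ Δ.chartOpen k τ from le_inf (hW _ hστ₀) (hW _ hτ)))
      ((D.pullback_pow_isSection_iff k σ m s).1 hs τ₀ τ)
    rw [map_mul, ← hf τ, ← hf τ₀, res_res, res_res, res_res, Δ.res_orbitClosureFun k σ hτ,
      Δ.res_orbitClosureFun k σ hστ₀, Δ.res_orbitClosureFun k σ hmeet, ← map_mul,
      ← _root_.sub_eq_zero, ← map_sub, Δ.orbitClosureFun_eq_zero_iff k le_rfl, coordMap_refl,
      RingHom.id_apply, map_sub, _root_.sub_eq_zero, map_mul, character_pow] at h1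
    rw [h1, orbitRingHom_coordMap_character k hmeet]
    · rfl
    · intro x hx
      change pair (m • (D.localForm τ₀ - D.localForm τ)) x = 0
      rw [pair_nsmul, D.sub_eq_zero τ₀ τ σ hστ₀ hτ x hx, mul_zero]
  obtain ⟨w₀, hw₀⟩ : ∃ w₀, (orbitRingHom k σ.1 (coordMap k hστ₀ (f τ₀))).coeff w₀ ≠ 0 := by
    by_contra! hcon
    have h0 : orbitRingHom k σ.1 (coordMap k hστ₀ (f τ₀)) = 0 :=
      AddMonoidAlgebra.coeff_injective (Finsupp.ext hcon)
    rw [← Δ.orbitClosureFun_eq_zero_iff k hστ₀, hf] at h0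
    exact hτ₀ h0
  refine ⟨m, w₀ + m • D.localForm τ₀, hm, fun τ hτ => ?_⟩
  refine mem_of_coeff_orbitRingHom_ne_zero k hτ (f τ) _ ?_
  have hw : w₀ + m • D.localForm τ₀ - m • D.localForm τ =
      m • (D.localForm τ₀ - D.localForm τ) + w₀ := by
    rw [smul_sub]; abel
  rw [hrel τ hτ, hw, AddMonoidAlgebra.coeff_single_mul_eq_mul_coeff (m₂ := w₀), one_mul]
  · exact hw₀
  · exact fun _ _ => add_right_inj _

/-- The characters `χ^{w - m u(τ)}` are regular on `U_τ` and differ by the transition functions. The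
section is nonzero since on `U_σ` the exponent vanishes on `σ`, so that the character restricts to a
nonzero monomial on the orbit. -/
theorem CartierDivisor.isEffective_of_form (D : CartierDivisor Δ) (σ : Δ.Cone) (m : ℕ)
    (w : DualLattice N) (hm : 0 < m) (hw : ∀ τ : Δ.Cone, σ ≤ τ →
      (∀ x ∈ σ.1, pair (w - m • D.localForm τ) x = 0) ∧
      ∀ x ∈ τ.1, 0 ≤ pair (w - m • D.localForm τ) x) :
    ((D.lineBundle k).pullback (Δ.orbitClosureι k σ)).IsEffective := by
  classical
  let s : ∀ τ : Δ.Cone, Γ(Δ.orbitClosure k σ, Δ.orbitClosureι k σ ⁻¹ᵁ Δ.chartOpen k τ) :=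
    fun τ => if h : σ ≤ τ then
      -- On the remaining charts `V(σ) ∩ U_τ` is empty, and `0` is the only function.
      Δ.orbitClosureFun k σ τ (character k ⟨w - m • D.localForm τ, (hw τ h).2⟩) else 0
  refine ⟨m, hm, s, (D.pullback_pow_isSection_iff k σ m s).2 fun τ τ' => ?_, fun h0 => ?_⟩
  · by_cases h : σ ≤ τ ∧ σ ≤ τ'
    · have hcomm : ∀ (ρ : Δ.Cone) (hρ : Δ.meet τ τ' ≤ ρ)
          (hW : Δ.orbitClosureι k σ ⁻¹ᵁ Δ.chartOpen k τ ⊓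
            Δ.orbitClosureι k σ ⁻¹ᵁ Δ.chartOpen k τ' ≤ Δ.orbitClosureι k σ ⁻¹ᵁ Δ.chartOpen k ρ)
          (g : CoordRing k ρ.1), res _ hW (Δ.orbitClosureFun k σ ρ g) =
            res _ (Δ.preimage_inf_chartOpen_le k σ τ τ')
              (Δ.orbitClosureFun k σ _ (coordMap k hρ g)) := by
        intro ρ hρ hW g
        rw [← Δ.res_orbitClosureFun k σ hρ (Δ.preimage_chartOpen_mono k σ hρ), res_res]
      simp only [s, dif_pos h.1, dif_pos h.2]
      refine (hcomm τ' (Δ.meet_le_right τ τ') _ _).trans (Eq.trans ?_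
        (congrArg _ (hcomm τ (Δ.meet_le_left τ τ') _ _).symm))
      rw [← map_mul, ← map_mul, coordMap_character, coordMap_character, character_pow,
        character_mul]
      congr 3
      ext1
      change w - m • D.localForm τ' = m • (D.localForm τ - D.localForm τ') +
        (w - m • D.localForm τ)
      rw [smul_sub]
      abel
    · have hbot : Δ.orbitClosureι k σ ⁻¹ᵁ Δ.chartOpen k τ ⊓
          Δ.orbitClosureι k σ ⁻¹ᵁ Δ.chartOpen k τ' = ⊥ := by
        rw [not_and_or] at h
        rcases h with h | h
        · rw [Δ.orbitClosure_preimage_eq_bot k h, bot_inf_eq]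
        · rw [Δ.orbitClosure_preimage_eq_bot k h, inf_bot_eq]
      exact (subsingleton_of_eq_bot hbot).elim _ _
  · have h1 : Δ.orbitClosureFun k σ σ
        (character k ⟨w - m • D.localForm σ, (hw σ le_rfl).2⟩) = 0 :=
      (dif_pos le_rfl).symm.trans (congrFun h0 σ)
    rw [Δ.orbitClosureFun_eq_zero_iff k le_rfl, orbitRingHom_coordMap_character k _
      ⟨w - m • D.localForm σ, (hw σ le_rfl).2⟩ (hw σ le_rfl).1, AddMonoidAlgebra.single_eq_zero] at h1
    exact one_ne_zero h1

end Effective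

/-- A lattice form `w` such that the characters `χ^{w - m u(τ)}` define a nonzero section on the
orbit closure of `σ` provides an equivalent divisor that is effective along `star¹(σ)`. -/
theorem CartierDivisor.exists_linearlyEquivalent_of_form {N : Type u} [AddCommGroup N]
    [Module.Free ℤ N] {Δ : Fan N} (D : CartierDivisor Δ) (σ : Δ.Cone) (m : ℕ) (w : DualLattice N)
    (hm : 0 < m) (hw : ∀ τ : Δ.Cone, σ ≤ τ →
      (∀ x ∈ σ.1, pair (w - m • D.localForm τ) x = 0) ∧
      ∀ x ∈ τ.1, 0 ≤ pair (w - m • D.localForm τ) x) :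
    ∃ a' : Δ.Ray → ℝ, LinearlyEquivalent Δ (fun i => (D.coeff i : ℝ)) a' ∧
      (∀ i : Δ.Ray, i.1 ≤ σ → a' i = 0) ∧ ∀ i : Δ.Ray, i.1 ∈ Δ.starOne σ → 0 ≤ a' i := by
  have hm' : (0 : ℝ) < m := by exact_mod_cast hm
  -- The coefficient `a_i + ⟨w, v_i⟩ / m` can be computed with any cone `τ` containing the ray; for
  -- rays of `star¹(σ)` one may take `τ ⊇ σ`.
  have hval : ∀ (τ : Δ.Cone) (i : Δ.Ray), i.1 ≤ τ →
      (D.coeff i : ℝ) + (m : ℝ)⁻¹ * w (Δ.rayVec i) =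
        (m : ℝ)⁻¹ * pair (w - m • D.localForm τ) (latticeVec (Δ.rayVec i)) := by
    intro τ i hi
    rw [pair_sub, pair_nsmul, pair_latticeVec, pair_latticeVec, D.localForm_rayVec hi]
    push_cast
    field_simp
    ring
  refine ⟨fun i => D.coeff i + (m : ℝ)⁻¹ * w (Δ.rayVec i), ?_, fun i hi => ?_, fun i hi => ?_⟩
  · have : (fun i => (D.coeff i : ℝ) + (m : ℝ)⁻¹ * w (Δ.rayVec i)) - (fun i => (D.coeff i : ℝ)) =
        (m : ℝ)⁻¹ • divCharacter Δ w := by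
      funext i
      simp [divCharacter]
    rw [LinearlyEquivalent, this]
    exact Submodule.smul_mem _ _ (Submodule.subset_span ⟨w, rfl⟩)
  · dsimp only
    rw [hval σ i hi, (hw σ le_rfl).1 _ (hi (Δ.rayVec_mem i)), mul_zero]
  · obtain ⟨τ, hστ, -, hiτ⟩ := hi
    dsimp only
    rw [hval τ i hiτ]
    exact mul_nonneg (inv_nonneg.2 hm'.le) ((hw τ hστ).2 _ (hiτ (Δ.rayVec_mem i)))

end Toric

end

theorem proposition2p6 {N : Type u} [AddCommGroup N] [Module.Free ℤ N] [Module.Finite ℤ N]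
    (Δ : Toric.Fan N) (k : Type u) [Field k] (D : Toric.CartierDivisor Δ) (σ : Δ.Cone) :
    List.TFAE [
      ((D.lineBundle k).pullback (Δ.orbitClosureι k σ)).IsEffective,
      ∃ a' : Δ.Ray → ℝ, Toric.LinearlyEquivalent Δ (fun i => (D.coeff i : ℝ)) a' ∧
        (∀ i : Δ.Ray, i.1 ≤ σ → a' i = 0) ∧
        ∀ i : Δ.Ray, i.1 ∈ Δ.starOne σ → 0 ≤ a' i,
      Toric.ConvexOnStarOne σ D.psi,
      ∀ b : Δ.Ray → ℝ, ∑ i, b i • Toric.latticeVec (Δ.rayVec i) = 0 →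
        (∀ i : Δ.Ray, i.1 ∉ Δ.starOne σ → b i = 0) →
        (∀ i : Δ.Ray, i.1 ∈ Δ.starOne σ → ¬ i.1 ≤ σ → 0 ≤ b i) →
        0 ≤ ∑ i, (D.coeff i : ℝ) * b i] := by
  tfae_have 1 → 2 := fun h => by
    obtain ⟨m, w, hm, hw⟩ := D.exists_form_of_isEffective k σ h
    exact D.exists_linearlyEquivalent_of_form σ m w hm hw
  tfae_have 2 → 3 := fun ⟨_, h, hσ, hstar⟩ => D.convexOnStarOne σ h hσ hstar
  tfae_have 3 → 4 := fun h b hb hb0 hb1 => D.sum_coeff_mul_nonneg σ h b hb hb0 hb1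
  tfae_have 4 → 1 := fun h => by
    obtain ⟨m, w, hm, hw⟩ := D.exists_form σ h
    exact D.isEffective_of_form k σ m w hm hw
  tfae_finish
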